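/- All graphs are simplicial (no loops, no multiple edges), and all vertex-groups of graph products are non-trivial. Given a simplicial graph $\Gamma$ and a collection $\mathcal{G}=\{G_u \mid u\in V(\Gamma)\}$ of non-trivial groups, the graph product $\Gamma\mathcal{G}$ is the quotient of the free product of the groups $G_u$, $u \in V(\Gamma)$, by the normal closure of all the commutators $[g,h]$ with $g\in G_u$, $h\in G_v$ and $u,v$ adjacent. For a set $S$ of vertices, $\langle S\rangle\leq\Gamma\mathcal{G}$ denotes the subgroup generated by the vertex-groups $G_u$ with $u\in S$. A group $A$ is graphically irreducible if, for every simplicial graph $\Gamma$ (possibly infinite) and every collection $\mathcal{G}$ of non-trivial groups indexed by $V(\Gamma)$ such that $A$ is isomorphic to $\Gamma\mathcal{G}$, the graph $\Gamma$ is complete. For vertices $u,v$ of a graph, $\mathrm{link}(u)$ is the set of neighbours of $u$ and $\mathrm{star}(u)=\mathrm{link}(u)\cup\{u\}$; we write $u\prec v$ if $\mathrm{link}(u)\subseteq\mathrm{star}(v)$. This is a preorder; $[u]=\{v \mid u\prec v \text{ and } v\prec u\}$, and $u$ is $\prec$-maximal if, for every vertex $v$, $u\prec v$ implies $v\prec u$.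 **Theorem.** Let $\Phi,\Psi$ be two finite simplicial graphs and $\mathcal{G},\mathcal{H}$ two collections of (non-trivial) graphically irreducible groups indexed by $V(\Phi)$ and $V(\Psi)$ respectively. Assume that no two distinct vertices of $\Phi$ have the same star and that no two distinct vertices of $\Psi$ have the same star. For every isomorphism $\varphi:\Phi\mathcal{G}\to\Psi\mathcal{H}$ and every $\prec$-maximal vertex $u\in V(\Phi)$, there exist an element $g\in\Psi\mathcal{H}$ and a $\prec$-maximal vertex $v\in V(\Psi)$ such that $$\varphi(\langle[u]\rangle)=g\langle[v]\rangle g^{-1}.$$ -/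

import Mathlib

/-- The commutators `[g, h]` in the free product of the vertex-groups, for `g`, `h` in the
vertex-groups of two adjacent vertices. -/
def GraphProduct.relators {V : Type*} (Γ : SimpleGraph V) (G : V → Type*) [∀ v, Group (G v)] :
    Set (Monoid.CoprodI G) :=
  {x | ∃ u v : V, Γ.Adj u v ∧ ∃ (g : G u) (h : G v),
    x = (Monoid.CoprodI.of g : Monoid.CoprodI G) * Monoid.CoprodI.of h *
      (Monoid.CoprodI.of g)⁻¹ * (Monoid.CoprodI.of h)⁻¹}

/-- The graph product `ΓG`: the free product of the vertex-groups modulo the normal closure of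
the commutators of elements of adjacent vertex-groups. -/
abbrev GraphProduct {V : Type*} (Γ : SimpleGraph V) (G : V → Type*) [∀ v, Group (G v)] :=
  Monoid.CoprodI G ⧸ Subgroup.normalClosure (GraphProduct.relators Γ G)

namespace GraphProduct

/-- The canonical morphism from a vertex-group to the graph product. -/
def of {V : Type*} (Γ : SimpleGraph V) (G : V → Type*) [∀ v, Group (G v)] (v : V) :
    G v →* GraphProduct Γ G :=
  (QuotientGroup.mk' (Subgroup.normalClosure (GraphProduct.relators Γ G))).comp
    Monoid.CoprodI.of

/-- The subgroup `⟨S⟩` generated by the vertex-groups indexed by the vertices in `S`. -/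
def vertexSubgroup {V : Type*} (Γ : SimpleGraph V) (G : V → Type*) [∀ v, Group (G v)]
    (S : Set V) : Subgroup (GraphProduct Γ G) :=
  ⨆ v ∈ S, (of Γ G v).range

end GraphProduct

/-- A group is graphically irreducible if, whenever it is isomorphic to a graph product of
non-trivial groups over a (possibly infinite) simplicial graph, this graph is complete.
Nothing is lost by taking the vertices and the vertex-groups in the universe of the group: the
vertex-groups embed in the graph product, and being non-trivial with pairwise trivial
intersections they are distinct subgroups, so every such decomposition is isomorphic to one over
vertices and vertex-groups in this universe. -/
def GraphicallyIrreducible.{u} (A : Type u) [Group A] : Prop :=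
  ∀ (V : Type u) (Γ : SimpleGraph V) (K : V → Type u) [∀ v, Group (K v)] [∀ v, Nontrivial (K v)],
    Nonempty (A ≃* GraphProduct Γ K) → Γ = ⊤

namespace SimpleGraph

/-- The (vertex set of the) star of a vertex: the vertex together with its link. -/
def vertexStar {V : Type*} (Γ : SimpleGraph V) (u : V) : Set V :=
  insert u (Γ.neighborSet u)

/-- The relation `u ≺ v`, that is, `link(u) ⊆ star(v)`. -/
def Prec {V : Type*} (Γ : SimpleGraph V) (u v : V) : Prop :=
  Γ.neighborSet u ⊆ Γ.vertexStar v

/-- `u` is maximal for the preorder `≺`. -/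
def IsPrecMaximal {V : Type*} (Γ : SimpleGraph V) (u : V) : Prop :=
  ∀ v : V, Γ.Prec u v → Γ.Prec v u

/-- The class `[u]` of `u` for the relation `u ≺ v ∧ v ≺ u`. -/
def precClass {V : Type*} (Γ : SimpleGraph V) (u : V) : Set V :=
  {v | Γ.Prec u v ∧ Γ.Prec v u}

end SimpleGraph

/-!
The class of a maximal vertex is recognised algebraically inside the graph product.

The first step is to see how commuting subgroups sit in a graph product. Call a set of vertices
irreducible if it has at least two elements and is not a join. Two non-trivial commuting subgroups
with trivial intersection are contained in a conjugate of `⟨S⟩` for some `S` which is not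
irreducible (`GraphProduct.exists_not_isIrred`). This comes from the decomposition of the graph
product as an amalgam of `⟨star v⟩` and `⟨V \ {v}⟩` over `⟨link v⟩`: otherwise a subgroup generated by
two commuting elements would act freely on the Bass-Serre tree, and hence embed in a free group. The
tree itself is not constructed; cocycles with values in a free group, which are defined on the
vertex-groups, play its role.

Graphical irreducibility is used through the recognition theorem `GraphicallyIrreducible.adj`. It
has two consequences. A graphically irreducible direct factor of `⟨K⟩ × ⟨U⟩`, where no vertex of `U`
is adjacent to all the others, lies in `⟨K⟩` (`GraphicallyIrreducible.le_vertexSubgroup`), and a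
graphically irreducible subgroup of a free product `⟨N₀⟩ * ⟨N₁⟩` which contains `⟨N₀⟩ ≠ 1` is equal
to `⟨N₀⟩` (`GraphicallyIrreducible.eq_vertexSubgroup`).

Let `u` be a maximal vertex. Since distinct vertices have distinct stars, no neighbour `p` of `u`
satisfies `u ≺ p`. Start from the set `N` of all the vertices, for which `φ⟨N⟩` is conjugate to some
`⟨N'⟩`. As long as `N` is larger than `[u]`, pass to a smaller set with the same property which
still contains `[u]`: to `{u}` if `u` is adjacent to all the other vertices of `N`, to a factor of
the join if `N` is a join, and to a maximal join in `N` around `u` otherwise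
(`GraphProduct.exists_ssubset_map_eq`). Hence `φ⟨[u]⟩` is conjugate to some `⟨N'⟩`.

Comparing centralisers, `φ⟨[u]⟩` then contains a conjugate of `⟨[v]⟩` for a maximal vertex `v` above
a vertex of `N'` (`GraphProduct.exists_precClass_le_map`). The same statement for `φ⁻¹` and `v`
gives, up to conjugation, some `⟨[u']⟩` inside `φ⁻¹⟨[v]⟩`, and hence inside `⟨[u]⟩`. Since `⟨[u]⟩`
properly contains none of its conjugates, all these inclusions are equalities.
-/

open Function

theorem exists_mul_of_mem_sup {M : Type*} [Group M] {A C : Subgroup M}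
    (hAC : ∀ a ∈ A, ∀ c ∈ C, Commute a c) {x : M} (hx : x ∈ A ⊔ C) :
    ∃ a ∈ A, ∃ c ∈ C, a * c = x := by
  have h := MonoidHom.noncommCoprod_range A.subtype C.subtype
    (fun a c => hAC a a.2 c c.2)
  rw [Subgroup.range_subtype, Subgroup.range_subtype] at h
  rw [← h] at hx
  obtain ⟨⟨a, c⟩, rfl⟩ := hx
  exact ⟨a, a.2, c, c.2, rfl⟩

namespace GraphProduct

variable {V : Type*} {Γ : SimpleGraph V} {G : V → Type*} [∀ v, Group (G v)]

/-! ### Universal property, generation and retractions -/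

theorem of_commute {u v : V} (h : Γ.Adj u v) (g : G u) (k : G v) :
    Commute (of Γ G u g) (of Γ G v k) := by
  have h1 : (QuotientGroup.mk' (Subgroup.normalClosure (relators Γ G)))
      ((Monoid.CoprodI.of g : Monoid.CoprodI G) * Monoid.CoprodI.of k *
      (Monoid.CoprodI.of g)⁻¹ * (Monoid.CoprodI.of k)⁻¹) = 1 := by
    rw [QuotientGroup.mk'_apply, QuotientGroup.eq_one_iff]
    exact Subgroup.subset_normalClosure ⟨u, v, h, g, k, rfl⟩
  simp only [map_mul, map_inv] at h1
  have h2 := mul_inv_eq_one.1 h1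
  exact mul_inv_eq_iff_eq_mul.1 h2

/-- The universal property of the graph product: morphisms defined on the vertex-groups, with
commuting images for adjacent vertices, extend to the graph product. -/
def lift {M : Type*} [Group M] (f : ∀ v, G v →* M)
    (hf : ∀ u v, Γ.Adj u v → ∀ (g : G u) (k : G v), Commute (f u g) (f v k)) :
    GraphProduct Γ G →* M :=
  QuotientGroup.lift _ (Monoid.CoprodI.lift f) (by
    refine Subgroup.normalClosure_le_normal ?_
    · rintro x ⟨u, v, h, g, k, rfl⟩
      have := hf u v h g k
      simp only [Commute, SemiconjBy] at this
      simp [this])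

@[simp]
theorem lift_of {M : Type*} [Group M] (f : ∀ v, G v →* M)
    (hf : ∀ u v, Γ.Adj u v → ∀ (g : G u) (k : G v), Commute (f u g) (f v k)) (v : V) (g : G v) :
    lift f hf (of Γ G v g) = f v g := by
  show QuotientGroup.lift _ (Monoid.CoprodI.lift f) _ (QuotientGroup.mk _) = _
  rw [QuotientGroup.lift_mk]
  simp

theorem le_of_forall_of_mem {K : Subgroup (GraphProduct Γ G)}
    (h : ∀ v g, of Γ G v g ∈ K) (x : GraphProduct Γ G) : x ∈ K := by
  induction x using QuotientGroup.induction_on with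
  | H z =>
    induction z using Monoid.CoprodI.induction_on with
    | one => exact K.one_mem
    | of v g => exact h v g
    | mul a b ha hb => exact K.mul_mem ha hb

theorem of_mem {S : Set V} {v : V} (hv : v ∈ S) (g : G v) :
    of Γ G v g ∈ vertexSubgroup Γ G S :=
  le_iSup₂ (f := fun v (_ : v ∈ S) => (of Γ G v).range) v hv ⟨g, rfl⟩

theorem vertexSubgroup_le {S : Set V} {K : Subgroup (GraphProduct Γ G)} :
    vertexSubgroup Γ G S ≤ K ↔ ∀ v ∈ S, ∀ g, of Γ G v g ∈ K := by
  refine ⟨fun h v hv g => h (of_mem hv g), fun h => iSup₂_le fun v hv => ?_⟩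
  rintro _ ⟨g, rfl⟩
  exact h v hv g

theorem vertexSubgroup_mono {S T : Set V} (h : S ⊆ T) :
    vertexSubgroup Γ G S ≤ vertexSubgroup Γ G T :=
  vertexSubgroup_le.2 fun _ hv g => of_mem (h hv) g

@[simp]
theorem vertexSubgroup_univ : vertexSubgroup Γ G Set.univ = ⊤ :=
  top_le_iff.1 fun x _ => le_of_forall_of_mem (fun _ g => of_mem (Set.mem_univ _) g) x

@[simp]
theorem vertexSubgroup_empty : vertexSubgroup Γ G ∅ = ⊥ :=
  le_bot_iff.1 (vertexSubgroup_le.2 fun _ h => h.elim)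

theorem vertexSubgroup_union (S T : Set V) :
    vertexSubgroup Γ G (S ∪ T) = vertexSubgroup Γ G S ⊔ vertexSubgroup Γ G T := by
  apply le_antisymm
  · rw [vertexSubgroup_le]
    rintro v (hv | hv) g
    · exact Subgroup.mem_sup_left (of_mem hv g)
    · exact Subgroup.mem_sup_right (of_mem hv g)
  · exact sup_le (vertexSubgroup_mono Set.subset_union_left)
      (vertexSubgroup_mono Set.subset_union_right)

theorem mem_vertexSubgroup_singleton {v : V} {x : GraphProduct Γ G} :
    x ∈ vertexSubgroup Γ G {v} ↔ ∃ g, of Γ G v g = x := by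
  simp [vertexSubgroup]

open Classical in
/-- The retraction of the graph product onto `⟨S⟩` killing the vertex-groups outside of `S`. -/
noncomputable def retract (Γ : SimpleGraph V) (G : V → Type*) [∀ v, Group (G v)] (S : Set V) :
    GraphProduct Γ G →* GraphProduct Γ G :=
  lift (fun v => if v ∈ S then of Γ G v else 1) (by
    intro u v h g k
    by_cases hu : u ∈ S <;> by_cases hv : v ∈ S <;> simp [hu, hv, of_commute h])

theorem retract_of_mem {S : Set V} {v : V} (hv : v ∈ S) (g : G v) :
    retract Γ G S (of Γ G v g) = of Γ G v g := by
  simp [retract, hv]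

theorem retract_of_not_mem {S : Set V} {v : V} (hv : v ∉ S) (g : G v) :
    retract Γ G S (of Γ G v g) = 1 := by
  simp [retract, hv]

theorem retract_mem_of_mem {S T : Set V} {x : GraphProduct Γ G}
    (hx : x ∈ vertexSubgroup Γ G T) : retract Γ G S x ∈ vertexSubgroup Γ G (S ∩ T) := by
  suffices vertexSubgroup Γ G T ≤ (vertexSubgroup Γ G (S ∩ T)).comap (retract Γ G S) from this hx
  rw [vertexSubgroup_le]
  intro v hv g
  by_cases hS : v ∈ S
  · rw [Subgroup.mem_comap, retract_of_mem hS]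
    exact of_mem (S := S ∩ T) ⟨hS, hv⟩ g
  · rw [Subgroup.mem_comap, retract_of_not_mem hS]
    exact Subgroup.one_mem _

theorem retract_mem (S : Set V) (x : GraphProduct Γ G) :
    retract Γ G S x ∈ vertexSubgroup Γ G S := by
  have := retract_mem_of_mem (S := S) (T := Set.univ) (x := x) (by simp)
  simpa using this

theorem retract_eq_self {S : Set V} {x : GraphProduct Γ G} (hx : x ∈ vertexSubgroup Γ G S) :
    retract Γ G S x = x := by
  suffices vertexSubgroup Γ G S ≤ (retract Γ G S).eqLocus (MonoidHom.id _) from this hx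
  exact vertexSubgroup_le.2 fun v hv g => retract_of_mem hv g

theorem retract_retract (S T : Set V) (x : GraphProduct Γ G) :
    retract Γ G S (retract Γ G T x) = retract Γ G (S ∩ T) x := by
  suffices x ∈ ((retract Γ G S).comp (retract Γ G T)).eqLocus (retract Γ G (S ∩ T)) from this
  refine le_of_forall_of_mem (fun v g => ?_) x
  show retract Γ G S (retract Γ G T (of Γ G v g)) = _
  by_cases hT : v ∈ T
  · rw [retract_of_mem hT]
    by_cases hS : v ∈ S
    · rw [retract_of_mem hS, retract_of_mem (S := S ∩ T) ⟨hS, hT⟩]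
    · rw [retract_of_not_mem hS, retract_of_not_mem (S := S ∩ T) fun h => hS h.1]
  · rw [retract_of_not_mem hT, retract_of_not_mem (S := S ∩ T) fun h => hT h.2, map_one]

theorem retract_eq_one {S T : Set V} (h : Disjoint S T) {x : GraphProduct Γ G}
    (hx : x ∈ vertexSubgroup Γ G T) : retract Γ G S x = 1 := by
  have := retract_mem_of_mem (S := S) hx
  rwa [h.inter_eq, vertexSubgroup_empty, Subgroup.mem_bot] at this

theorem map_retract (S T : Set V) :
    (vertexSubgroup Γ G T).map (retract Γ G S) = vertexSubgroup Γ G (S ∩ T) := by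
  apply le_antisymm
  · rintro _ ⟨x, hx, rfl⟩
    exact retract_mem_of_mem hx
  · intro x hx
    exact ⟨x, vertexSubgroup_mono Set.inter_subset_right hx,
      retract_eq_self (vertexSubgroup_mono Set.inter_subset_left hx)⟩

theorem vertexSubgroup_inf (S T : Set V) :
    vertexSubgroup Γ G S ⊓ vertexSubgroup Γ G T = vertexSubgroup Γ G (S ∩ T) := by
  apply le_antisymm
  · rintro x ⟨hS, hT⟩
    have := retract_mem_of_mem (S := S) hT
    rwa [retract_eq_self hS] at this
  · exact le_inf (vertexSubgroup_mono Set.inter_subset_left)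
      (vertexSubgroup_mono Set.inter_subset_right)

theorem mem_vertexSubgroup_of_compl [Finite V] {S : Set V} {x : GraphProduct Γ G}
    (h : ∀ v, v ∉ S → x ∈ vertexSubgroup Γ G {v}ᶜ) : x ∈ vertexSubgroup Γ G S := by
  have key : ∀ T : Set V, T.Finite → T ⊆ Sᶜ → x ∈ vertexSubgroup Γ G Tᶜ := by
    intro T hT
    induction T, hT using Set.Finite.induction_on with
    | empty => simp
    | insert _ _ ih =>
      intro hTS
      rename_i a s _ _
      have h1 := ih ((Set.subset_insert _ _).trans hTS)
      have h2 := h a (hTS (Set.mem_insert _ _))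
      have h3 : x ∈ vertexSubgroup Γ G {a}ᶜ ⊓ vertexSubgroup Γ G sᶜ := ⟨h2, h1⟩
      rw [vertexSubgroup_inf] at h3
      rwa [Set.insert_eq, Set.compl_union]
  have := key Sᶜ (Set.toFinite _) subset_rfl
  rwa [compl_compl] at this

theorem of_injective (v : V) : Injective (of Γ G v) := by
  classical
  let f : GraphProduct Γ G →* (∀ v, G v) := lift (fun v => MonoidHom.mulSingle G v)
    (fun u v h g k => Pi.mulSingle_commute h.ne g k)
  intro a b hab
  have h1 := congrArg f hab
  simp only [f] at h1
  exact Pi.mulSingle_injective v h1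

theorem of_eq_one_of_mem {S : Set V} {v : V} (hv : v ∉ S) {g : G v}
    (h : of Γ G v g ∈ vertexSubgroup Γ G S) : g = 1 := by
  have := retract_eq_self h
  rw [retract_of_not_mem hv] at this
  exact of_injective v (this.symm.trans (map_one _).symm)

theorem vertexSubgroup_le_iff [∀ v, Nontrivial (G v)] {S T : Set V} :
    vertexSubgroup Γ G S ≤ vertexSubgroup Γ G T ↔ S ⊆ T := by
  refine ⟨fun h v hv => ?_, vertexSubgroup_mono⟩
  by_contra hT
  obtain ⟨g, hg⟩ := exists_ne (1 : G v)
  exact hg (of_eq_one_of_mem hT (h (of_mem hv g)))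

theorem vertexSubgroup_eq_bot_iff [∀ v, Nontrivial (G v)] {S : Set V} :
    vertexSubgroup Γ G S = ⊥ ↔ S = ∅ := by
  rw [← le_bot_iff, ← vertexSubgroup_empty (Γ := Γ), vertexSubgroup_le_iff, Set.subset_empty_iff]

/-- Two sets of vertices are joined if every vertex of the first is adjacent to every vertex of
the second; in particular they are disjoint. -/
def Joined (Γ : SimpleGraph V) (S T : Set V) : Prop := ∀ s ∈ S, ∀ t ∈ T, Γ.Adj s t

theorem Joined.symm {S T : Set V} (h : Joined Γ S T) : Joined Γ T S :=
  fun t ht s hs => (h s hs t ht).symm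

theorem Joined.mono {S T S' T' : Set V} (h : Joined Γ S T) (hS : S' ⊆ S) (hT : T' ⊆ T) :
    Joined Γ S' T' :=
  fun s hs t ht => h s (hS hs) t (hT ht)

theorem Joined.disjoint {S T : Set V} (h : Joined Γ S T) : Disjoint S T :=
  Set.disjoint_left.2 fun v hS hT => (h v hS v hT).ne rfl

theorem commute_of_forall {M : Type*} [Group M] {f : ∀ v, G v →* M}
    {hf : ∀ u v, Γ.Adj u v → ∀ (g : G u) (k : G v), Commute (f u g) (f v k)}
    {S : Set V} {y : M} (h : ∀ v ∈ S, ∀ g, Commute (f v g) y) {x : GraphProduct Γ G}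
    (hx : x ∈ vertexSubgroup Γ G S) : Commute (lift f hf x) y := by
  suffices vertexSubgroup Γ G S ≤ (Subgroup.centralizer {y}).comap (lift f hf) by
    have := this hx
    rw [Subgroup.mem_comap, Subgroup.mem_centralizer_singleton_iff] at this
    exact this
  refine vertexSubgroup_le.2 fun v hv g => ?_
  rw [Subgroup.mem_comap, Subgroup.mem_centralizer_singleton_iff, lift_of]
  exact h v hv g

theorem commute_of_forall_of {S : Set V} {x y : GraphProduct Γ G}
    (h : ∀ v ∈ S, ∀ g, Commute (of Γ G v g) y) (hx : x ∈ vertexSubgroup Γ G S) :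
    Commute x y := by
  suffices vertexSubgroup Γ G S ≤ Subgroup.centralizer {y} from
    Subgroup.mem_centralizer_singleton_iff.1 (this hx)
  exact vertexSubgroup_le.2 fun v hv g => Subgroup.mem_centralizer_singleton_iff.2 (h v hv g)

theorem Joined.commute {S T : Set V} (h : Joined Γ S T) {x y : GraphProduct Γ G}
    (hx : x ∈ vertexSubgroup Γ G S) (hy : y ∈ vertexSubgroup Γ G T) : Commute x y :=
  commute_of_forall_of (fun s hs g =>
    (commute_of_forall_of (fun t ht k => of_commute (h s hs t ht).symm k g) hy).symm) hx

theorem Joined.retract_mul_retract {S T : Set V} (h : Joined Γ S T) {x : GraphProduct Γ G}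
    (hx : x ∈ vertexSubgroup Γ G (S ∪ T)) : retract Γ G S x * retract Γ G T x = x := by
  rw [vertexSubgroup_union] at hx
  obtain ⟨a, ha, b, hb, rfl⟩ := exists_mul_of_mem_sup (fun a ha b hb => h.commute ha hb) hx
  rw [map_mul, map_mul, retract_eq_self ha, retract_eq_self hb, retract_eq_one h.disjoint hb,
    retract_eq_one h.disjoint.symm ha, one_mul, mul_one]

end GraphProduct

/-! ### The splitting over the link of a vertex -/

/-- Two commuting elements of a free group generating subgroups with trivial intersection are not
both non-trivial: by the Nielsen-Schreier theorem they are powers of a common element. -/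
theorem FreeGroup.eq_one_of_commute {α : Type*} {a b : FreeGroup α} (h : Commute a b)
    (hd : ∀ i j : ℤ, a ^ i = b ^ j → a ^ i = 1) : a = 1 ∨ b = 1 := by
  let H : Subgroup (FreeGroup α) := Subgroup.closure {a, b}
  have hcomm : ∀ x y : H, x * y = y * x := by
    have : IsMulCommutative H := Subgroup.isMulCommutative_closure (by
      rintro x (rfl | rfl) y (rfl | rfl)
      · rfl
      · exact h
      · exact h.symm
      · rfl)
    exact fun x y => mul_comm' x y
  let e := IsFreeGroup.mulEquiv H
  have hsub : Subsingleton (IsFreeGroup.Generators H) := by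
    refine ⟨fun i j => ?_⟩
    by_contra hij
    have h1 : FreeGroup.of i * FreeGroup.of j = FreeGroup.of j * FreeGroup.of i := by
      apply e.injective
      exact (e.map_mul _ _).trans ((hcomm _ _).trans (e.map_mul _ _).symm)
    classical
    have h2 := congrArg FreeGroup.toWord h1
    have h3 : ∀ i j : IsFreeGroup.Generators H, FreeGroup.toWord (FreeGroup.of i * FreeGroup.of j) =
        [(i, true), (j, true)] := by
      intro i j
      show FreeGroup.toWord (FreeGroup.mk [(i, true), (j, true)]) = _
      rw [FreeGroup.toWord_mk]
      simp [FreeGroup.reduce]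
    rw [h3, h3] at h2
    simp at h2
    exact hij h2.1
  obtain ⟨c, hc⟩ : ∃ c : FreeGroup (IsFreeGroup.Generators H), ∀ x, ∃ i : ℤ, x = c ^ i := by
    rcases isEmpty_or_nonempty (IsFreeGroup.Generators H) with hE | ⟨⟨s⟩⟩
    · exact ⟨1, fun x => ⟨0, Subsingleton.elim _ _⟩⟩
    · refine ⟨FreeGroup.of s, fun x => ?_⟩
      suffices x ∈ Subgroup.zpowers (FreeGroup.of s) by
        obtain ⟨i, hi⟩ := this
        exact ⟨i, hi.symm⟩
      induction x using FreeGroup.induction_on with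
      | C1 => exact Subgroup.one_mem _
      | of t => rw [Subsingleton.elim t s]; exact Subgroup.mem_zpowers _
      | inv_of t ht => exact Subgroup.inv_mem _ ht
      | mul x y hx hy => exact Subgroup.mul_mem _ hx hy
  have hcyc : ∀ x ∈ H, ∃ i : ℤ, x = ((e c : H) : FreeGroup α) ^ i := by
    intro x hx
    obtain ⟨i, hi⟩ := hc (e.symm ⟨x, hx⟩)
    refine ⟨i, ?_⟩
    have := congrArg e hi
    rw [MulEquiv.apply_symm_apply, map_zpow] at this
    exact congrArg Subtype.val this
  obtain ⟨i, hi⟩ := hcyc a (Subgroup.subset_closure (by simp))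
  obtain ⟨j, hj⟩ := hcyc b (Subgroup.subset_closure (by simp))
  have h1 : a ^ j = b ^ i := by rw [hi, hj, ← zpow_mul, ← zpow_mul, mul_comm]
  have h2 := hd j i h1
  by_cases hj0 : j = 0
  · right; rw [hj, hj0, zpow_zero]
  · left
    exact (IsMulTorsionFree.zpow_eq_one_iff_left hj0).1 h2

namespace GraphProduct

variable {V : Type*} {Γ : SimpleGraph V} {G : V → Type*} [∀ v, Group (G v)]

section Skew

variable {X K : Type*} [Group K] (α : GraphProduct Γ G →* Equiv.Perm X)
  (c : ∀ w, G w → X → K)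
  (hc : ∀ w g h x, c w (g * h) x = c w g (α (of Γ G w h) x) * c w h x)
  (hcomm : ∀ u w, Γ.Adj u w → ∀ g k x,
    c u g (α (of Γ G w k) x) * c w k x = c w k (α (of Γ G u g) x) * c u g x)

/-- The action of a vertex-group on `X × K` given by an action on `X` and a `K`-valued cocycle. -/
def skewVertex (w : V) : G w →* Equiv.Perm (X × K) where
  toFun g :=
    { toFun := fun p => (α (of Γ G w g) p.1, c w g p.1 * p.2)
      invFun := fun p => (α (of Γ G w g⁻¹) p.1, c w g⁻¹ p.1 * p.2)
      left_inv := fun p => by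
        have h1 := hc w g⁻¹ g p.1
        have h2 : c w 1 p.1 = 1 := by simpa using hc w 1 1 p.1
        rw [inv_mul_cancel, h2] at h1
        refine Prod.ext (by simp) ?_
        simp only [← mul_assoc, ← h1, one_mul]
      right_inv := fun p => by
        have h1 := hc w g g⁻¹ p.1
        have h2 : c w 1 p.1 = 1 := by simpa using hc w 1 1 p.1
        rw [mul_inv_cancel, h2] at h1
        refine Prod.ext (by simp) ?_
        simp only [← mul_assoc, ← h1, one_mul] }
  map_one' := Equiv.ext fun p => by
    have h1 : c w 1 p.1 = 1 := by simpa using hc w 1 1 p.1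
    exact Prod.ext (by simp) (by simp [h1])
  map_mul' g h := Equiv.ext fun p => Prod.ext (by simp) (by simp [hc, mul_assoc])

theorem skewVertex_commute (hcomm : ∀ u w, Γ.Adj u w → ∀ g k x,
    c u g (α (of Γ G w k) x) * c w k x = c w k (α (of Γ G u g) x) * c u g x)
    (u w : V) (h : Γ.Adj u w) (g : G u) (k : G w) :
    Commute (skewVertex α c hc u g) (skewVertex α c hc w k) := Equiv.ext fun p => by
  refine Prod.ext ?_ ?_
  · have := congrArg (fun z => α z p.1) (of_commute h g k).eq
    rw [map_mul, map_mul] at this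
    exact this
  · have := hcomm u w h g k p.1
    show c u g (α (of Γ G w k) p.1) * (c w k p.1 * p.2) =
      c w k (α (of Γ G u g) p.1) * (c u g p.1 * p.2)
    rw [← mul_assoc, this, mul_assoc]

/-- The action of the graph product on `X × K` given by an action on `X` and a `K`-valued cocycle,
which is prescribed on the vertex-groups. -/
def skew : GraphProduct Γ G →* Equiv.Perm (X × K) :=
  lift (skewVertex α c hc) (skewVertex_commute α c hc hcomm)

theorem skew_of (w : V) (g : G w) (p : X × K) :
    skew α c hc hcomm (of Γ G w g) p = (α (of Γ G w g) p.1, c w g p.1 * p.2) := by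
  rw [skew, lift_of]
  rfl

/-- The cocycle defining the action `skew`. -/
def cocycle (g : GraphProduct Γ G) (x : X) : K := (skew α c hc hcomm g (x, 1)).2

theorem skew_apply (g : GraphProduct Γ G) (p : X × K) :
    skew α c hc hcomm g p = (α g p.1, cocycle α c hc hcomm g p.1 * p.2) := by
  let T : Subgroup (GraphProduct Γ G) :=
    { carrier := {g | ∃ f : X → K, ∀ p, skew α c hc hcomm g p = (α g p.1, f p.1 * p.2)}
      one_mem' := ⟨fun _ => 1, fun p => by simp⟩
      mul_mem' := by
        rintro a b ⟨f, hf⟩ ⟨f', hf'⟩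
        refine ⟨fun x => f (α b x) * f' x, fun p => ?_⟩
        rw [map_mul, Equiv.Perm.mul_apply, hf', hf, map_mul, Equiv.Perm.mul_apply, mul_assoc]
      inv_mem' := by
        rintro a ⟨f, hf⟩
        refine ⟨fun x => (f (α a⁻¹ x))⁻¹, fun p => ?_⟩
        rw [map_inv, Equiv.Perm.inv_eq_iff_eq, hf]
        simp }
  obtain ⟨f, hf⟩ : g ∈ T := le_of_forall_of_mem (K := T)
    (fun v g => ⟨c v g, fun p => skew_of α c hc hcomm v g p⟩) g
  have h1 : cocycle α c hc hcomm g p.1 = f p.1 := by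
    rw [cocycle, hf, mul_one]
  rw [hf, h1]

theorem cocycle_of (w : V) (g : G w) (x : X) :
    cocycle α c hc hcomm (of Γ G w g) x = c w g x := by
  rw [cocycle, skew_of, mul_one]

theorem cocycle_mul (g h : GraphProduct Γ G) (x : X) :
    cocycle α c hc hcomm (g * h) x =
      cocycle α c hc hcomm g (α h x) * cocycle α c hc hcomm h x := by
  rw [cocycle, map_mul, Equiv.Perm.mul_apply, skew_apply α c hc hcomm h, skew_apply, mul_one]

theorem cocycle_one (x : X) : cocycle α c hc hcomm 1 x = 1 := by
  rw [cocycle, map_one]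
  rfl

theorem cocycle_eq_one {S : Set V} (hS : ∀ w ∈ S, ∀ g x, c w g x = 1) {g : GraphProduct Γ G}
    (hg : g ∈ vertexSubgroup Γ G S) (x : X) : cocycle α c hc hcomm g x = 1 := by
  let T : Subgroup (GraphProduct Γ G) :=
    { carrier := {g | ∀ x, cocycle α c hc hcomm g x = 1}
      one_mem' := cocycle_one α c hc hcomm
      mul_mem' := fun ha hb x => by rw [cocycle_mul, ha, hb, one_mul]
      inv_mem' := fun {a} ha x => by
        have h := cocycle_mul α c hc hcomm a a⁻¹ x
        rw [mul_inv_cancel, cocycle_one, ha, one_mul] at h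
        exact h.symm }
  have : vertexSubgroup Γ G S ≤ T := vertexSubgroup_le.2 fun w hw g x => by
    rw [cocycle_of, hS w hw]
  exact this hg x

end Skew

/-- The reduced products `p₁q₁⋯pₙqₙ`, `n ≥ 1`, for the decomposition of the graph product as an
amalgam of `⟨star v⟩` and `⟨V \ {v}⟩` over `⟨link v⟩`: every `pᵢ` is a non-trivial element of the
vertex-group of `v`, every `qᵢ` is in `⟨V \ {v}⟩`, and none of `q₁, …, qₙ₋₁` is in `⟨link v⟩`. -/
inductive AmalgamReduced (Γ : SimpleGraph V) (G : V → Type*) [∀ v, Group (G v)] (v : V) :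
    GraphProduct Γ G → Prop
  | single (p : G v) (q : GraphProduct Γ G) (hp : p ≠ 1) (hq : q ∈ vertexSubgroup Γ G {v}ᶜ) :
      AmalgamReduced Γ G v (of Γ G v p * q)
  | cons (p : G v) (q h : GraphProduct Γ G) (hp : p ≠ 1) (hq : q ∈ vertexSubgroup Γ G {v}ᶜ)
      (hqL : q ∉ vertexSubgroup Γ G (Γ.neighborSet v)) (hh : AmalgamReduced Γ G v h) :
      AmalgamReduced Γ G v (of Γ G v p * q * h)

theorem commute_of_link {v : V} {q : GraphProduct Γ G}
    (hq : q ∈ vertexSubgroup Γ G (Γ.neighborSet v)) (p : G v) : Commute (of Γ G v p) q :=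
  Joined.commute (S := {v}) (T := Γ.neighborSet v) (by
    intro s hs t ht
    rw [Set.mem_singleton_iff] at hs
    rw [hs]
    exact ht) (of_mem (Set.mem_singleton v) p) hq

theorem link_le_compl (v : V) :
    vertexSubgroup Γ G (Γ.neighborSet v) ≤ vertexSubgroup Γ G {v}ᶜ :=
  vertexSubgroup_mono fun w hw h => by
    rw [Set.mem_singleton_iff] at h
    subst h
    exact Γ.loopless.irrefl _ hw

/-- Every element outside of `⟨V \ {v}⟩` is the product of an element of `⟨V \ {v}⟩` and of a reduced
product. -/
theorem exists_amalgamReduced (v : V) (g : GraphProduct Γ G) :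
    g ∈ vertexSubgroup Γ G {v}ᶜ ∨
      ∃ q ∈ vertexSubgroup Γ G {v}ᶜ, ∃ h, AmalgamReduced Γ G v h ∧ g = q * h := by
  let P : GraphProduct Γ G → Prop := fun g => g ∈ vertexSubgroup Γ G {v}ᶜ ∨
      ∃ q ∈ vertexSubgroup Γ G {v}ᶜ, ∃ h, AmalgamReduced Γ G v h ∧ g = q * h
  have hQ : ∀ q ∈ vertexSubgroup Γ G {v}ᶜ, ∀ g, P g → P (q * g) := by
    rintro q hq g (hg | ⟨q', hq', h, hh, rfl⟩)
    · exact Or.inl (mul_mem hq hg)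
    · exact Or.inr ⟨q * q', mul_mem hq hq', h, hh, (mul_assoc _ _ _).symm⟩
  have hR : ∀ h, AmalgamReduced Γ G v h → P h := fun h hh =>
    Or.inr ⟨1, one_mem _, h, hh, (one_mul _).symm⟩
  have hP : ∀ p : G v, ∀ g, P g → P (of Γ G v p * g) := by
    intro p g hg
    by_cases hp : p = 1
    · rwa [hp, map_one, one_mul]
    rcases hg with hg | ⟨q, hq, h, hh, rfl⟩
    · exact hR _ (.single p g hp hg)
    by_cases hqL : q ∈ vertexSubgroup Γ G (Γ.neighborSet v)
    · rw [← mul_assoc, (commute_of_link hqL p).eq, mul_assoc]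
      apply hQ q hq
      cases hh with
      | single p' q' hp' hq' =>
        rw [← mul_assoc, ← map_mul]
        by_cases hpp : p * p' = 1
        · rw [hpp, map_one, one_mul]; exact Or.inl hq'
        · exact hR _ (.single _ q' hpp hq')
      | cons p' q' h' hp' hq' hqL' hh' =>
        rw [← mul_assoc, ← mul_assoc, ← map_mul]
        by_cases hpp : p * p' = 1
        · rw [hpp, map_one, one_mul]; exact hQ q' hq' _ (hR _ hh')
        · exact hR _ (.cons _ q' h' hpp hq' hqL' hh')
    · rw [← mul_assoc]
      exact hR _ (.cons p q h hp hq hqL hh)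
  let T : Subgroup (GraphProduct Γ G) :=
    { carrier := {x | (∀ g, P g → P (x * g)) ∧ ∀ g, P g → P (x⁻¹ * g)}
      one_mem' := by simp
      mul_mem' := fun {a b} ha hb =>
        ⟨fun g hg => by rw [mul_assoc]; exact ha.1 _ (hb.1 g hg),
          fun g hg => by rw [mul_inv_rev, mul_assoc]; exact hb.2 _ (ha.2 g hg)⟩
      inv_mem' := fun {a} ha => ⟨ha.2, by simpa using ha.1⟩ }
  have hT : g ∈ T := le_of_forall_of_mem (K := T) (fun w k => by
    by_cases hw : w = v
    · subst hw
      exact ⟨hP k, by rw [← map_inv]; exact hP k⁻¹⟩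
    · have := of_mem (Γ := Γ) (S := {v}ᶜ) hw k
      exact ⟨hQ _ this, hQ _ (inv_mem this)⟩) g
  have := hT.1 1 (Or.inl (one_mem _))
  rwa [mul_one] at this

section Edges

variable (v : V) (X : Type*) [MulAction (GraphProduct Γ G) X]

/-- The orbits of `⟨link v⟩` on `X`. For `X` the set of cosets of a subgroup, these are the edges
of the quotient, by this subgroup, of the Bass-Serre tree of the splitting of the graph product
over `⟨link v⟩`. -/
abbrev LinkOrbits := MulAction.orbitRel.Quotient (vertexSubgroup Γ G (Γ.neighborSet v)) X

variable {X}

/-- The orbit of a point under `⟨link v⟩`. -/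
def linkOrbit (x : X) : LinkOrbits (Γ := Γ) (G := G) v X := Quotient.mk'' x

theorem linkOrbit_eq {x y : X} : linkOrbit (Γ := Γ) (G := G) v x = linkOrbit v y ↔
    ∃ l ∈ vertexSubgroup Γ G (Γ.neighborSet v), l • y = x := by
  rw [linkOrbit, linkOrbit, Quotient.eq'', MulAction.orbitRel_apply, MulAction.mem_orbit_iff]
  constructor
  · rintro ⟨l, hl⟩
    exact ⟨l, l.2, hl⟩
  · rintro ⟨l, hl, h⟩
    exact ⟨⟨l, hl⟩, h⟩

variable (X)

open Classical in
/-- The values on the vertex-groups of the cocycle recording, as elements of the free group on the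
orbits of `⟨link v⟩`, the edges crossed by a path in the Bass-Serre tree. -/
noncomputable def edgeValue (w : V) (g : G w) (x : X) :
    FreeGroup (LinkOrbits (Γ := Γ) (G := G) v X) :=
  if w = v then
    (FreeGroup.of (linkOrbit v (of Γ G w g • x)))⁻¹ * FreeGroup.of (linkOrbit v x) else 1

/-- The cocycle on the graph product extending `edgeValue`. -/
noncomputable def edgeCocycle (g : GraphProduct Γ G) (x : X) :
    FreeGroup (LinkOrbits (Γ := Γ) (G := G) v X) :=
  cocycle (MulAction.toPermHom (GraphProduct Γ G) X) (edgeValue v X)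
    (by
      intro w g h x
      by_cases hw : w = v <;> simp [edgeValue, hw, mul_smul, mul_assoc])
    (by
      have key : ∀ w, Γ.Adj v w → ∀ (g : G v) (k : G w) (x : X),
          edgeValue (Γ := Γ) v X v g (of Γ G w k • x) * edgeValue (Γ := Γ) v X w k x =
          edgeValue (Γ := Γ) v X w k (of Γ G v g • x) * edgeValue (Γ := Γ) v X v g x := by
        intro w h g k x
        have hw : w ≠ v := h.ne'
        have h1 : linkOrbit (Γ := Γ) (G := G) v (of Γ G w k • x) = linkOrbit v x :=
          (linkOrbit_eq v).2 ⟨_, of_mem h k, rfl⟩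
        have h2 : linkOrbit (Γ := Γ) (G := G) v (of Γ G v g • of Γ G w k • x) =
            linkOrbit v (of Γ G v g • x) := by
          rw [← mul_smul, (of_commute h g k).eq, mul_smul]
          exact (linkOrbit_eq v).2 ⟨_, of_mem h k, rfl⟩
        simp [edgeValue, hw, h1, h2]
      intro u w h g k x
      by_cases hu : u = v
      · subst hu
        exact key w h g k x
      by_cases hw : w = v
      · subst hw
        exact (key u h.symm k g x).symm
      simp [edgeValue, hu, hw]) g x

variable {X}

theorem edgeCocycle_mul (g h : GraphProduct Γ G) (x : X) :
    edgeCocycle v X (g * h) x = edgeCocycle v X g (h • x) * edgeCocycle v X h x :=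
  cocycle_mul _ _ _ _ g h x

theorem edgeCocycle_of (p : G v) (x : X) : edgeCocycle v X (of Γ G v p) x =
    (FreeGroup.of (linkOrbit v (of Γ G v p • x)))⁻¹ * FreeGroup.of (linkOrbit v x) := by
  rw [edgeCocycle, cocycle_of, edgeValue, if_pos rfl]

theorem edgeCocycle_eq_one {q : GraphProduct Γ G} (hq : q ∈ vertexSubgroup Γ G {v}ᶜ) (x : X) :
    edgeCocycle v X q x = 1 :=
  cocycle_eq_one _ _ _ _ (fun _ hw _ _ => if_neg hw) hq x

variable (Γ G X)

/-- The two sides of the splitting over `⟨link v⟩` act on `X` as freely as needed for an element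
not in `⟨link v⟩` to change the orbits of points under `⟨link v⟩`. -/
structure IsEdgeFree : Prop where
  vertex : ∀ (p : G v), ∀ l ∈ vertexSubgroup Γ G (Γ.neighborSet v), ∀ x : X,
    of Γ G v p • x = l • x → p = 1
  compl : ∀ q ∈ vertexSubgroup Γ G {v}ᶜ, ∀ l ∈ vertexSubgroup Γ G (Γ.neighborSet v), ∀ x : X,
    q • x = l • x → q ∈ vertexSubgroup Γ G (Γ.neighborSet v)

variable {Γ G X v}

/-- The edge cocycle of a reduced product is given by a reduced word, whose last letter only
depends on the last factor of the product. -/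
theorem AmalgamReduced.exists_word (hX : IsEdgeFree Γ G v X) {h : GraphProduct Γ G}
    (hh : AmalgamReduced Γ G v h) :
    ∃ q ∈ vertexSubgroup Γ G {v}ᶜ, ∀ x : X,
      ∃ L : List (LinkOrbits (Γ := Γ) (G := G) v X × Bool),
        FreeGroup.IsReduced L ∧ edgeCocycle v X h x = FreeGroup.mk L ∧
        L.head? = some (linkOrbit v (h • x), false) ∧
        L.getLast? = some (linkOrbit v (q • x), true) := by
  have hp : ∀ p : G v, p ≠ 1 → ∀ x : X,
      linkOrbit (Γ := Γ) (G := G) v (of Γ G v p • x) ≠ linkOrbit v x := by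
    intro p hp x hx
    obtain ⟨l, hl, h⟩ := (linkOrbit_eq v).1 hx
    exact hp (hX.vertex p l hl x h.symm)
  induction hh with
  | single p q hp1 hq =>
    refine ⟨q, hq, fun x => ⟨[(linkOrbit v (of Γ G v p • q • x), false),
      (linkOrbit v (q • x), true)], ?_, ?_, ?_, rfl⟩⟩
    · simp [FreeGroup.IsReduced, hp p hp1]
    · rw [edgeCocycle_mul, edgeCocycle_eq_one v hq, mul_one, edgeCocycle_of]
      rfl
    · rw [mul_smul]; rfl
  | cons p q h hp1 hq hqL hh ih =>
    obtain ⟨r, hr, ih⟩ := ih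
    refine ⟨r, hr, fun x => ?_⟩
    obtain ⟨L, hL, hc, hhead, hlast⟩ := ih x
    have hqx : linkOrbit (Γ := Γ) (G := G) v (q • h • x) ≠ linkOrbit v (h • x) := by
      intro hx
      obtain ⟨l, hl, h⟩ := (linkOrbit_eq v).1 hx
      exact hqL (hX.compl q hq l hl _ h.symm)
    refine ⟨(linkOrbit v (of Γ G v p • q • h • x), false) :: (linkOrbit v (q • h • x), true) :: L,
      ?_, ?_, ?_, ?_⟩
    · cases L with
      | nil => simp at hhead
      | cons a L =>
        simp only [List.head?_cons, Option.some.injEq] at hhead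
        subst hhead
        rw [FreeGroup.isReduced_cons_cons, FreeGroup.isReduced_cons_cons]
        exact ⟨fun h => absurd h (hp p hp1 _), fun h => absurd h hqx, hL⟩
    · rw [edgeCocycle_mul, edgeCocycle_mul, edgeCocycle_eq_one v hq, mul_one, edgeCocycle_of, hc]
      rfl
    · rw [mul_smul, mul_smul]; rfl
    · cases L with
      | nil => simp at hhead
      | cons a L => simpa using hlast

end Edges

/-- If `g ∉ ⟨V \ {v}⟩`, then `⟨V \ {v}⟩` intersects its conjugate by `g` inside a conjugate of
`⟨link v⟩`: the path between two distinct vertices of the Bass-Serre tree has an edge. -/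
theorem exists_conj_mem_link {v : V} {g : GraphProduct Γ G}
    (hg : g ∉ vertexSubgroup Γ G {v}ᶜ) :
    ∃ q : GraphProduct Γ G, ∀ x ∈ vertexSubgroup Γ G {v}ᶜ,
      g⁻¹ * x * g ∈ vertexSubgroup Γ G {v}ᶜ →
        q⁻¹ * x * q ∈ vertexSubgroup Γ G (Γ.neighborSet v) := by
  have hX : IsEdgeFree Γ G v (GraphProduct Γ G) := by
    constructor
    · intro p l hl x h
      have h1 : of Γ G v p = l := mul_right_cancel h
      exact of_eq_one_of_mem (S := {v}ᶜ) (by simp) (h1 ▸ link_le_compl v hl)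
    · intro q _ l hl x h
      have h1 : q = l := mul_right_cancel h
      exact h1 ▸ hl
  obtain ⟨q₀, hq₀, h, hh, rfl⟩ := (exists_amalgamReduced v g).resolve_left hg
  obtain ⟨q, -, hq⟩ := hh.exists_word hX
  refine ⟨q₀ * h * q⁻¹, fun x hx hy => ?_⟩
  set y := (q₀ * h)⁻¹ * x * (q₀ * h) with hydef
  have hxy : x * (q₀ * h) = (q₀ * h) * y := by rw [hydef]; group
  have h1 : edgeCocycle v (GraphProduct Γ G) h y = edgeCocycle v (GraphProduct Γ G) h 1 := by
    have := congrArg (fun z => edgeCocycle v (GraphProduct Γ G) z 1) hxy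
    simpa [edgeCocycle_mul, edgeCocycle_eq_one v hx, edgeCocycle_eq_one v hy,
      edgeCocycle_eq_one v hq₀] using this.symm
  obtain ⟨L, hL, hc, -, hlast⟩ := hq y
  obtain ⟨L', hL', hc', -, hlast'⟩ := hq 1
  have hLL : L = L' := by
    classical
    rw [← hL.reduce_eq, ← hL'.reduce_eq]
    exact FreeGroup.reduce.sound (by rw [← hc, ← hc', h1])
  rw [hLL, hlast'] at hlast
  simp only [Option.some.injEq, Prod.mk.injEq, and_true] at hlast
  obtain ⟨l, hl, hlq⟩ := (linkOrbit_eq v).1 hlast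
  have hlq' : l * (q * y) = q := by simpa using hlq
  have h2 : (q₀ * h * q⁻¹)⁻¹ * x * (q₀ * h * q⁻¹) = l⁻¹ := by
    have h3 : (q₀ * h * q⁻¹)⁻¹ * x * (q₀ * h * q⁻¹) = q * y * q⁻¹ := by rw [hydef]; group
    rw [h3, mul_inv_eq_iff_eq_mul, eq_inv_mul_iff_mul_eq]
    exact hlq'
  rw [h2]
  exact inv_mem hl

/-- Two commuting elements generating a subgroup which acts freely on the Bass-Serre tree of the
splitting over `⟨link v⟩`, and two cyclic subgroups with trivial intersection, cannot both be
non-trivial: the subgroup embeds in a free group. -/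
theorem eq_one_of_commute_of_free {v : V} {a b : GraphProduct Γ G} (hab : Commute a b)
    (hd : ∀ i j : ℤ, a ^ i = b ^ j → a ^ i = 1)
    (hstar : ∀ g, ∀ x ∈ Subgroup.closure {a, b}, g⁻¹ * x * g ∈
      vertexSubgroup Γ G (Γ.vertexStar v) → x = 1)
    (hcompl : ∀ g, ∀ x ∈ Subgroup.closure {a, b}, g⁻¹ * x * g ∈
      vertexSubgroup Γ G {v}ᶜ → x = 1) : a = 1 ∨ b = 1 := by
  set E := Subgroup.closure {a, b} with hE
  have hfix : ∀ (g z l : GraphProduct Γ G), z • (g : GraphProduct Γ G ⧸ E) = l • ↑g →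
      g⁻¹ * (l⁻¹ * z) * g ∈ E := by
    intro g z l h
    rw [eq_comm, MulAction.Quotient.smul_coe, MulAction.Quotient.smul_coe, QuotientGroup.eq] at h
    simpa [mul_assoc] using h
  have hX : IsEdgeFree Γ G v (GraphProduct Γ G ⧸ E) := by
    constructor
    · intro p l hl x h
      induction x using QuotientGroup.induction_on with
      | H g =>
        have h1 := hstar g⁻¹ _ (hfix g _ l h) (by
          have h2 : g⁻¹⁻¹ * (g⁻¹ * (l⁻¹ * of Γ G v p) * g) * g⁻¹ = l⁻¹ * of Γ G v p := by group
          rw [h2]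
          exact mul_mem (inv_mem (vertexSubgroup_mono (Set.subset_insert _ _) hl))
            (of_mem (Set.mem_insert _ _) p))
        have h2 : of Γ G v p = l := by
          have : l⁻¹ * of Γ G v p = 1 := by
            rw [← conj_eq_one_iff (a := g⁻¹), inv_inv]; exact h1
          exact (inv_mul_eq_one.1 this).symm
        exact of_eq_one_of_mem (S := {v}ᶜ) (by simp) (h2 ▸ link_le_compl v hl)
    · intro q hq l hl x h
      induction x using QuotientGroup.induction_on with
      | H g =>
        have h1 := hcompl g⁻¹ _ (hfix g _ l h) (by
          have h2 : g⁻¹⁻¹ * (g⁻¹ * (l⁻¹ * q) * g) * g⁻¹ = l⁻¹ * q := by group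
          rw [h2]
          exact mul_mem (inv_mem (link_le_compl v hl)) hq)
        have h2 : q = l := by
          have : l⁻¹ * q = 1 := by
            rw [← conj_eq_one_iff (a := g⁻¹), inv_inv]; exact h1
          exact (inv_mul_eq_one.1 this).symm
        exact h2 ▸ hl
  let x₀ : GraphProduct Γ G ⧸ E := ((1 : GraphProduct Γ G) : GraphProduct Γ G ⧸ E)
  have hx₀ : ∀ g ∈ E, g • x₀ = x₀ := by
    intro g hg
    rw [MulAction.Quotient.smul_coe, QuotientGroup.eq]
    simpa using hg
  let θ : E →* FreeGroup (LinkOrbits (Γ := Γ) (G := G) v (GraphProduct Γ G ⧸ E)) :=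
    { toFun := fun g => edgeCocycle v _ g x₀
      map_one' := cocycle_one _ _ _ _ _
      map_mul' := fun g h => by
        rw [Subgroup.coe_mul, edgeCocycle_mul, hx₀ h h.2] }
  have hθ : Injective θ := by
    rw [injective_iff_map_eq_one]
    intro g hg
    by_contra hne
    rcases exists_amalgamReduced v (g : GraphProduct Γ G) with h1 | ⟨q₀, hq₀, h, hh, hgh⟩
    · exact hne (Subtype.ext (hcompl 1 g g.2 (by simpa using h1)))
    · obtain ⟨q, -, hq⟩ := hh.exists_word hX
      obtain ⟨L, hL, hc, hhead, -⟩ := hq x₀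
      have h2 : θ g = FreeGroup.mk L := by
        show edgeCocycle v _ (g : GraphProduct Γ G) x₀ = _
        rw [hgh, edgeCocycle_mul, edgeCocycle_eq_one v hq₀, one_mul, hc]
      rw [h2, FreeGroup.one_eq_mk] at hg
      have h3 : L = [] := by
        classical
        rw [← hL.reduce_eq]
        exact FreeGroup.reduce.sound hg
      simp [h3] at hhead
  have ha : a ∈ E := Subgroup.subset_closure (by simp)
  have hb : b ∈ E := Subgroup.subset_closure (by simp)
  have h1 := FreeGroup.eq_one_of_commute (a := θ ⟨a, ha⟩) (b := θ ⟨b, hb⟩)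
    (Commute.map (Subtype.ext hab.eq : (⟨a, ha⟩ : E) * ⟨b, hb⟩ = ⟨b, hb⟩ * ⟨a, ha⟩) θ) (by
      intro i j h
      rw [← map_zpow, ← map_zpow] at h
      have h2 := congrArg Subtype.val (hθ h)
      rw [← map_zpow, ← map_one θ]
      exact congrArg θ (Subtype.ext (hd i j h2)))
  rcases h1 with h1 | h1
  · exact Or.inl (congrArg Subtype.val (hθ (h1.trans (map_one θ).symm)))
  · exact Or.inr (congrArg Subtype.val (hθ (h1.trans (map_one θ).symm)))

end GraphProduct

/-! ### Parabolic subgroups -/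

/-- The conjugate `g A g⁻¹` of a subgroup `A`. -/
abbrev conjSubgroup {M : Type*} [Group M] (g : M) (A : Subgroup M) : Subgroup M :=
  A.map (MulAut.conj g).toMonoidHom

theorem mem_conjSubgroup {M : Type*} [Group M] {g x : M} {A : Subgroup M} :
    x ∈ conjSubgroup g A ↔ g⁻¹ * x * g ∈ A := by
  constructor
  · rintro ⟨a, ha, rfl⟩
    simpa [mul_assoc] using ha
  · intro h
    exact ⟨_, h, by simp [mul_assoc]⟩

namespace GraphProduct

variable {V : Type*} {Γ : SimpleGraph V} {G : V → Type*} [∀ v, Group (G v)]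

/-- The set of vertices which are adjacent to every vertex of `S`. -/
def commonLink (Γ : SimpleGraph V) (S : Set V) : Set V := {w | ∀ v ∈ S, Γ.Adj v w}

theorem joined_commonLink (S : Set V) : Joined Γ S (commonLink Γ S) :=
  fun s hs _ ht => ht s hs

theorem Joined.subset_commonLink {S T : Set V} (h : Joined Γ S T) : T ⊆ commonLink Γ S :=
  fun t ht s hs => h s hs t ht

theorem commonLink_anti {S T : Set V} (h : S ⊆ T) : commonLink Γ T ⊆ commonLink Γ S :=
  fun _ hw v hv => hw v (h hv)

/-- `A` is a subgroup of `⟨S⟩` which is not contained in a conjugate of `⟨R⟩` for a proper subset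
`R` of `S`. -/
def IsFull (Γ : SimpleGraph V) (G : V → Type*) [∀ v, Group (G v)] (S : Set V)
    (A : Subgroup (GraphProduct Γ G)) : Prop :=
  A ≤ vertexSubgroup Γ G S ∧
    ∀ R, R ⊂ S → ∀ g : GraphProduct Γ G, ¬ ∀ a ∈ A, g⁻¹ * a * g ∈ vertexSubgroup Γ G R

/-- The intersection of `⟨S⟩` with a conjugate of `⟨R⟩` is contained in a conjugate of `⟨S ∩ R⟩`
by an element of `⟨S⟩`: apply the retraction onto `⟨S⟩`. -/
theorem conj_retract_mem {S R : Set V} {x g : GraphProduct Γ G}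
    (hx : x ∈ vertexSubgroup Γ G S) (h : g⁻¹ * x * g ∈ vertexSubgroup Γ G R) :
    (retract Γ G S g)⁻¹ * x * retract Γ G S g ∈ vertexSubgroup Γ G (S ∩ R) := by
  have := retract_mem_of_mem (S := S) h
  rwa [map_mul, map_mul, map_inv, retract_eq_self hx] at this

/-- Up to conjugation, every subgroup is full in a parabolic subgroup: its parabolic closure. -/
theorem exists_isFull [Finite V] {S : Set V} {A : Subgroup (GraphProduct Γ G)}
    (hA : A ≤ vertexSubgroup Γ G S) :
    ∃ R ⊆ S, ∃ s ∈ vertexSubgroup Γ G S, IsFull Γ G R (conjSubgroup s⁻¹ A) := by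
  let P : Set V → Prop := fun R => R ⊆ S ∧
    ∃ s : GraphProduct Γ G, ∀ a ∈ A, s⁻¹ * a * s ∈ vertexSubgroup Γ G R
  obtain ⟨R, ⟨hRS, s, hs⟩, hmin⟩ := (Set.toFinite {R | P R}).exists_minimal
    ⟨S, subset_rfl, 1, fun a ha => by simpa using hA ha⟩
  refine ⟨R, hRS, retract Γ G S s, retract_mem S s, ?_, fun T hT g hg => ?_⟩
  · intro x hx
    rw [mem_conjSubgroup] at hx
    have h1 := conj_retract_mem (hA hx) (hs _ hx)
    refine vertexSubgroup_mono (Set.inter_subset_right (s := S)) ?_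
    convert h1 using 1
    group
  · have hP : P T := ⟨hT.subset.trans hRS, retract Γ G S s * g, fun a ha => by
      convert hg ((retract Γ G S s)⁻¹ * a * retract Γ G S s)
        (mem_conjSubgroup.2 (by convert ha using 1; group)) using 1
      group⟩
    exact hT.not_subset (hmin hP hT.subset)

/-- An element which conjugates a full subgroup of `⟨S⟩` into `⟨S⟩` lies in the normaliser
`⟨S⟩ × ⟨commonLink S⟩` of `⟨S⟩`. If it involved another vertex `v`, the full subgroup would be
conjugate into `⟨link v⟩`. -/
theorem IsFull.mem_of_conj [Finite V] {S : Set V} {A : Subgroup (GraphProduct Γ G)}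
    (hA : IsFull Γ G S A) {n : GraphProduct Γ G}
    (hn : ∀ a ∈ A, n⁻¹ * a * n ∈ vertexSubgroup Γ G S) :
    n ∈ vertexSubgroup Γ G (S ∪ commonLink Γ S) := by
  refine mem_vertexSubgroup_of_compl fun v hv => ?_
  by_contra hnv
  obtain ⟨q, hq⟩ := exists_conj_mem_link hnv
  have hvS : v ∉ S := fun h => hv (Or.inl h)
  have hS : S ⊆ {v}ᶜ := fun w hw h => hvS (by rwa [← Set.mem_singleton_iff.1 h])
  refine hA.2 (S ∩ Γ.neighborSet v) ?_ (retract Γ G S q) fun a ha => ?_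
  · refine Set.inter_subset_left.ssubset_of_ne fun h => hv (Or.inr fun w hw => ?_)
    rw [← h] at hw
    exact hw.2.symm
  · exact conj_retract_mem (hA.1 ha)
      (hq a (vertexSubgroup_mono hS (hA.1 ha)) (vertexSubgroup_mono hS (hn a ha)))

theorem conj_mem_iff {S : Set V} {n : GraphProduct Γ G}
    (hn : n ∈ vertexSubgroup Γ G (S ∪ commonLink Γ S)) (x : GraphProduct Γ G) :
    n⁻¹ * x * n ∈ vertexSubgroup Γ G S ↔ x ∈ vertexSubgroup Γ G S := by
  rw [vertexSubgroup_union] at hn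
  obtain ⟨a, ha, b, hb, rfl⟩ :=
    exists_mul_of_mem_sup (fun a ha b hb => (joined_commonLink S).commute ha hb) hn
  constructor
  · intro h
    have h1 : b * ((a * b)⁻¹ * x * (a * b)) * b⁻¹ = (a * b)⁻¹ * x * (a * b) := by
      rw [mul_inv_eq_iff_eq_mul]
      exact ((joined_commonLink S).commute h hb).symm.eq
    have h2 : x = a * (b * ((a * b)⁻¹ * x * (a * b)) * b⁻¹) * a⁻¹ := by group
    rw [h2, h1]
    exact mul_mem (mul_mem ha h) (inv_mem ha)
  · intro h
    have h1 : a⁻¹ * x * a ∈ vertexSubgroup Γ G S := mul_mem (mul_mem (inv_mem ha) h) ha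
    have h2 : (a * b)⁻¹ * x * (a * b) = b⁻¹ * ((a⁻¹ * x * a) * b) := by group
    rw [h2, ((joined_commonLink S).commute h1 hb).eq, inv_mul_cancel_left]
    exact h1

theorem subset_of_conj_mem [∀ v, Nontrivial (G v)] {S R : Set V} {n : GraphProduct Γ G}
    (h : ∀ x ∈ vertexSubgroup Γ G S, n⁻¹ * x * n ∈ vertexSubgroup Γ G R) : S ⊆ R := by
  have h1 : vertexSubgroup Γ G S ≤ vertexSubgroup Γ G (S ∩ R) := by
    intro y hy
    have hs := retract_mem (Γ := Γ) (G := G) S n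
    have := conj_retract_mem (mul_mem (mul_mem hs hy) (inv_mem hs))
      (h _ (mul_mem (mul_mem hs hy) (inv_mem hs)))
    convert this using 1
    group
  exact (vertexSubgroup_le_iff.1 h1).trans Set.inter_subset_right

theorem isFull_vertexSubgroup [∀ v, Nontrivial (G v)] (S : Set V) :
    IsFull Γ G S (vertexSubgroup Γ G S) :=
  ⟨le_rfl, fun _ hR _ h => hR.not_subset (subset_of_conj_mem h)⟩

/-- A conjugate of `⟨S⟩` contained in `⟨S⟩` is equal to `⟨S⟩`. -/
theorem conjSubgroup_eq_of_le [Finite V] [∀ v, Nontrivial (G v)] {S : Set V}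
    {n : GraphProduct Γ G}
    (h : vertexSubgroup Γ G S ≤ conjSubgroup n (vertexSubgroup Γ G S)) :
    conjSubgroup n (vertexSubgroup Γ G S) = vertexSubgroup Γ G S := by
  have hn := (isFull_vertexSubgroup S).mem_of_conj fun x hx => mem_conjSubgroup.1 (h hx)
  ext x
  rw [mem_conjSubgroup, conj_mem_iff hn]

theorem mem_star_of_commute [Finite V] {v : V} {g : G v} (hg : g ≠ 1) {x : GraphProduct Γ G}
    (hx : Commute x (of Γ G v g)) : x ∈ vertexSubgroup Γ G (Γ.vertexStar v) := by
  have hfull : IsFull Γ G {v} (Subgroup.zpowers (of Γ G v g)) := by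
    refine ⟨?_, fun R hR n h => ?_⟩
    · rw [Subgroup.zpowers_le]
      exact of_mem (Set.mem_singleton v) g
    · rw [Set.ssubset_singleton_iff] at hR
      have := h _ (Subgroup.mem_zpowers _)
      rw [hR, vertexSubgroup_empty, Subgroup.mem_bot] at this
      have h2 : of Γ G v g = 1 := by
        rw [← conj_eq_one_iff (a := n⁻¹), inv_inv]; exact this
      exact hg (of_injective v (h2.trans (map_one _).symm))
  have h1 := hfull.mem_of_conj (n := x) (by
    rintro a ⟨i, rfl⟩
    have : Commute x (of Γ G v g ^ i) := hx.zpow_right i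
    simp only
    rw [mul_assoc, ← this.eq, inv_mul_cancel_left]
    exact zpow_mem (of_mem (Set.mem_singleton v) g) i)
  refine vertexSubgroup_mono ?_ h1
  rintro w (hw | hw)
  · exact Or.inl hw
  · exact Or.inr (hw v rfl)

theorem mem_star_of_forall_commute [Finite V] [∀ v, Nontrivial (G v)] {v : V}
    {x : GraphProduct Γ G} (hx : ∀ g, Commute x (of Γ G v g)) :
    x ∈ vertexSubgroup Γ G (Γ.vertexStar v) := by
  obtain ⟨g, hg⟩ := exists_ne (1 : G v)
  exact mem_star_of_commute hg (hx g)

theorem adj_of_commute [Finite V] {u v : V} (huv : u ≠ v) {g : G u} (hg : g ≠ 1) {k : G v}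
    (hk : k ≠ 1) (h : Commute (of Γ G u g) (of Γ G v k)) : Γ.Adj u v := by
  have h1 := mem_star_of_commute hk h
  by_contra hadj
  refine hg (of_eq_one_of_mem (fun h2 => ?_) h1)
  rcases h2 with h2 | h2
  · exact huv h2
  · exact hadj (Γ.adj_symm h2)

/-- No vertex of `S` is adjacent to all the other vertices of `S`. -/
def ConeFree (Γ : SimpleGraph V) (S : Set V) : Prop := ∀ v ∈ S, ¬ S ⊆ Γ.vertexStar v

theorem mem_of_commute_vertexSubgroup [Finite V] [∀ v, Nontrivial (G v)] {S : Set V}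
    {x : GraphProduct Γ G} (hx : ∀ y ∈ vertexSubgroup Γ G S, Commute x y) :
    x ∈ vertexSubgroup Γ G {w | ∀ v ∈ S, w ∈ Γ.vertexStar v} := by
  refine mem_vertexSubgroup_of_compl fun w hw => ?_
  simp only [Set.mem_ofPred_eq, not_forall] at hw
  obtain ⟨v, hv, hwv⟩ := hw
  refine vertexSubgroup_mono ?_ (mem_star_of_forall_commute fun g => hx _ (of_mem hv g))
  intro z hz h
  rw [Set.mem_singleton_iff] at h
  exact hwv (h ▸ hz)

theorem mem_union_of_commute [Finite V] [∀ v, Nontrivial (G v)] {S : Set V}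
    {x : GraphProduct Γ G} (hx : ∀ y ∈ vertexSubgroup Γ G S, Commute x y) :
    x ∈ vertexSubgroup Γ G (S ∪ commonLink Γ S) := by
  refine vertexSubgroup_mono ?_ (mem_of_commute_vertexSubgroup hx)
  intro w hw
  by_cases hS : w ∈ S
  · exact Or.inl hS
  · exact Or.inr fun v hv => (hw v hv).resolve_left fun h => hS (h ▸ hv)

theorem ConeFree.mem_commonLink_of_commute [Finite V] [∀ v, Nontrivial (G v)] {S : Set V}
    (hS : ConeFree Γ S) {x : GraphProduct Γ G} (hx : ∀ y ∈ vertexSubgroup Γ G S, Commute x y) :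
    x ∈ vertexSubgroup Γ G (commonLink Γ S) := by
  refine vertexSubgroup_mono ?_ (mem_of_commute_vertexSubgroup hx)
  intro w hw v hv
  refine (hw v hv).resolve_left fun h => hS w (h ▸ hv) fun z hz => ?_
  rcases hw z hz with h1 | h1
  · exact Or.inl h1.symm
  · exact Or.inr (Γ.adj_symm h1)

theorem ConeFree.eq_one_of_commute [Finite V] [∀ v, Nontrivial (G v)] {S : Set V}
    (hS : ConeFree Γ S) {x : GraphProduct Γ G} (hxS : x ∈ vertexSubgroup Γ G S)
    (hx : ∀ y ∈ vertexSubgroup Γ G S, Commute x y) : x = 1 := by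
  have h1 : x ∈ vertexSubgroup Γ G S ⊓ vertexSubgroup Γ G (commonLink Γ S) :=
    ⟨hxS, hS.mem_commonLink_of_commute hx⟩
  rwa [vertexSubgroup_inf, (joined_commonLink S).disjoint.inter_eq, vertexSubgroup_empty,
    Subgroup.mem_bot] at h1

/-! ### Commuting subgroups -/

/-- `S` has at least two vertices and does not decompose as a join. -/
def IsIrred (Γ : SimpleGraph V) (S : Set V) : Prop :=
  S.Nontrivial ∧ ∀ R, R ⊂ S → R.Nonempty → ¬ S ⊆ R ∪ commonLink Γ R

theorem IsIrred.not_subset_star {S : Set V} (hS : IsIrred Γ S) {v : V} (hv : v ∈ S) :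
    ¬ S ⊆ Γ.vertexStar v := by
  intro h
  obtain ⟨w, hw, hwv⟩ := hS.1.exists_ne v
  refine hS.2 {v} ?_ ⟨v, rfl⟩ ?_
  · exact (Set.singleton_subset_iff.2 hv).ssubset_of_ne fun h1 => hwv (by rwa [← h1] at hw)
  · intro z hz
    rcases h hz with h1 | h1
    · exact Or.inl h1
    · right
      rintro x rfl
      exact h1

theorem IsIrred.coneFree {S : Set V} (hS : IsIrred Γ S) : ConeFree Γ S :=
  fun _ hv => hS.not_subset_star hv

theorem IsFull.of_conj {S : Set V} {A : Subgroup (GraphProduct Γ G)} {s : GraphProduct Γ G}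
    (hA : A ≤ vertexSubgroup Γ G S) (h : IsFull Γ G S (conjSubgroup s⁻¹ A)) :
    IsFull Γ G S A := by
  refine ⟨hA, fun R hR g hg => h.2 R hR (s⁻¹ * g) fun a ha => ?_⟩
  rw [mem_conjSubgroup] at ha
  convert hg _ ha using 1
  group

/-- A non-trivial subgroup normalised by a full subgroup is full. -/
theorem IsIrred.isFull_of_normalized [Finite V] {S : Set V} (hS : IsIrred Γ S)
    {D C : Subgroup (GraphProduct Γ G)} (hD : IsFull Γ G S D) (hCS : C ≤ vertexSubgroup Γ G S)
    (hC : C ≠ ⊥) (hDC : ∀ d ∈ D, ∀ c ∈ C, d⁻¹ * c * d ∈ C) : IsFull Γ G S C := by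
  obtain ⟨R, hR, s, hs, hfull⟩ := exists_isFull hCS
  by_cases hRS : R = S
  · subst hRS
    exact hfull.of_conj hCS
  exfalso
  have hRne : R.Nonempty := by
    rw [Set.nonempty_iff_ne_empty]
    rintro rfl
    apply hC
    have h1 := hfull.1
    rw [vertexSubgroup_empty, le_bot_iff, Subgroup.map_eq_bot_iff_of_injective] at h1
    · exact h1
    · exact (MulAut.conj s⁻¹).injective
  refine hD.2 (S ∩ (R ∪ commonLink Γ R)) ?_ (retract Γ G S s) fun d hd =>
    conj_retract_mem (hD.1 hd) (hfull.mem_of_conj fun a ha => hfull.1 ?_)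
  · exact Set.inter_subset_left.ssubset_of_ne fun h =>
      hS.2 R (hR.ssubset_of_ne hRS) hRne (Set.inter_eq_left.1 h)
  · rw [mem_conjSubgroup] at ha ⊢
    convert hDC d hd _ ha using 1
    group

/-- In an irreducible graph product, two non-trivial commuting subgroups with trivial intersection
are contained in a proper parabolic subgroup. Otherwise all the non-trivial elements of the
subgroup generated by two commuting elements would be full, so that it would act freely on the
Bass-Serre trees. -/
theorem IsIrred.not_isFull_sup [Finite V] {S : Set V} (hS : IsIrred Γ S)
    {A B : Subgroup (GraphProduct Γ G)} (hAB : ∀ a ∈ A, ∀ b ∈ B, Commute a b)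
    (hdisj : A ⊓ B = ⊥) (hA : A ≠ ⊥) (hB : B ≠ ⊥) : ¬ IsFull Γ G S (A ⊔ B) := by
  intro hfull
  have hAS : A ≤ vertexSubgroup Γ G S := le_sup_left.trans hfull.1
  have hBS : B ≤ vertexSubgroup Γ G S := le_sup_right.trans hfull.1
  have hBfull : IsFull Γ G S B := hS.isFull_of_normalized hfull hBS hB (by
    intro d hd c hc
    obtain ⟨a, ha, b, hb, rfl⟩ := exists_mul_of_mem_sup hAB hd
    have h2 : (a * b)⁻¹ * c * (a * b) = b⁻¹ * (a⁻¹ * (c * a)) * b := by group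
    rw [h2, ← (hAB a ha c hc).eq, inv_mul_cancel_left]
    exact mul_mem (mul_mem (inv_mem hb) hc) hb)
  have hcomm : ∀ x y : GraphProduct Γ G, Commute x y → x⁻¹ * y * x = y := fun x y h => by
    rw [mul_assoc, ← h.eq, inv_mul_cancel_left]
  obtain ⟨a, ha, ha1⟩ := A.bot_or_exists_ne_one.resolve_left hA
  obtain ⟨b, hb, hb1⟩ := B.bot_or_exists_ne_one.resolve_left hB
  have hafull : IsFull Γ G S (Subgroup.zpowers a) :=
    hS.isFull_of_normalized hBfull ((Subgroup.zpowers_le).2 (hAS ha)) (by simpa using ha1) (by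
      rintro d hd _ ⟨i, rfl⟩
      simp only
      rw [hcomm _ _ ((hAB a ha d hd).symm.zpow_right i)]
      exact Subgroup.zpow_mem_zpowers a i)
  have hEfull : ∀ c ∈ Subgroup.closure {a, b}, c ≠ 1 → IsFull Γ G S (Subgroup.zpowers c) := by
    intro c hc hc1
    have hac : Commute a c := by
      have : Subgroup.closure {a, b} ≤ Subgroup.centralizer {a} := by
        rw [Subgroup.closure_le]
        rintro z (rfl | rfl)
        · exact Subgroup.mem_centralizer_singleton_iff.2 rfl
        · exact Subgroup.mem_centralizer_singleton_iff.2 (hAB a ha z hb).symm.eq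
      exact (Subgroup.mem_centralizer_singleton_iff.1 (this hc) : c * a = a * c).symm
    refine hS.isFull_of_normalized hafull ?_ (by simpa using hc1) ?_
    · rw [Subgroup.zpowers_le]
      refine (Subgroup.closure_le _).2 ?_ hc
      rintro z (rfl | rfl)
      exacts [hAS ha, hBS hb]
    · rintro _ ⟨i, rfl⟩ _ ⟨j, rfl⟩
      simp only
      rw [hcomm _ _ (hac.zpow_zpow i j)]
      exact Subgroup.zpow_mem_zpowers c j
  have hproper : ∀ T : Set V, ¬ S ⊆ T → ∀ g, ∀ x ∈ Subgroup.closure {a, b},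
      g⁻¹ * x * g ∈ vertexSubgroup Γ G T → x = 1 := by
    intro T hT g x hx hg
    by_contra hx1
    have hf := hEfull x hx hx1
    refine hf.2 (S ∩ T) (Set.inter_subset_left.ssubset_of_ne fun h => hT (Set.inter_eq_left.1 h))
      (retract Γ G S g) fun y hy => conj_retract_mem (hf.1 hy) ?_
    obtain ⟨i, rfl⟩ := hy
    simp only
    have h1 : g⁻¹ * x ^ i * g = (g⁻¹ * x * g) ^ i := by
      have := (conj_zpow (i := i) (a := g⁻¹) (b := x)).symm
      rwa [inv_inv] at this
    rw [h1]
    exact zpow_mem hg i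
  -- Neither `star v` nor the complement of `v` contains `S`, so that the full subgroups generated by
  -- the non-trivial elements of `closure {a, b}` fix no vertex of the Bass-Serre tree.
  obtain ⟨v, hv⟩ := hS.1.nonempty
  rcases eq_one_of_commute_of_free (v := v) (hAB a ha b hb) (by
      intro i j hij
      have : a ^ i ∈ A ⊓ B := ⟨zpow_mem ha i, hij ▸ zpow_mem hb j⟩
      rwa [hdisj, Subgroup.mem_bot] at this)
    (hproper _ (hS.not_subset_star hv)) (hproper _ fun h => h hv rfl) with h | h
  exacts [ha1 h, hb1 h]

/-- Two non-trivial commuting subgroups with trivial intersection generate a subgroup whose parabolic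
closure is not irreducible. -/
theorem exists_not_isIrred [Finite V] {N : Set V} {A B : Subgroup (GraphProduct Γ G)}
    (hAN : A ≤ vertexSubgroup Γ G N) (hBN : B ≤ vertexSubgroup Γ G N)
    (hAB : ∀ a ∈ A, ∀ b ∈ B, Commute a b)
    (hdisj : A ⊓ B = ⊥) (hA : A ≠ ⊥) (hB : B ≠ ⊥) :
    ∃ S ⊆ N, ∃ s ∈ vertexSubgroup Γ G N, ¬ IsIrred Γ S ∧
      A ⊔ B ≤ conjSubgroup s (vertexSubgroup Γ G S) := by
  obtain ⟨S, hSN, s, hs, hfull⟩ := exists_isFull (sup_le hAN hBN)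
  refine ⟨S, hSN, s, hs, fun hS => ?_, fun x hx => ?_⟩
  · have hinj : Injective (MulAut.conj s⁻¹).toMonoidHom := (MulAut.conj s⁻¹).injective
    rw [show conjSubgroup s⁻¹ (A ⊔ B) = conjSubgroup s⁻¹ A ⊔ conjSubgroup s⁻¹ B from
      Subgroup.map_sup _ _ _] at hfull
    refine hS.not_isFull_sup ?_ ?_ ?_ ?_ hfull
    · rintro _ ⟨a, ha, rfl⟩ _ ⟨b, hb, rfl⟩
      exact (hAB a ha b hb).map _
    · rw [← Subgroup.map_inf _ _ _ hinj, hdisj, Subgroup.map_bot]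
    · rwa [Ne, Subgroup.map_eq_bot_iff_of_injective _ hinj]
    · rwa [Ne, Subgroup.map_eq_bot_iff_of_injective _ hinj]
  · rw [mem_conjSubgroup]
    refine hfull.1 ⟨x, hx, ?_⟩
    simp

theorem IsIrred.eq_bot_or_eq_bot [Finite V] [∀ v, Nontrivial (G v)] {S : Set V}
    (hS : IsIrred Γ S) {A B : Subgroup (GraphProduct Γ G)} (hAB : ∀ a ∈ A, ∀ b ∈ B, Commute a b)
    (hsup : A ⊔ B = vertexSubgroup Γ G S) : A = ⊥ ∨ B = ⊥ := by
  by_contra! h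
  refine hS.not_isFull_sup hAB ?_ h.1 h.2 (hsup ▸ isFull_vertexSubgroup S)
  rw [eq_bot_iff]
  rintro x ⟨hxA, hxB⟩
  have hxS : x ∈ vertexSubgroup Γ G S := hsup ▸ Subgroup.mem_sup_left hxA
  refine hS.coneFree.eq_one_of_commute hxS fun y hy => ?_
  rw [← hsup] at hy
  obtain ⟨a, ha, b, hb, rfl⟩ := exists_mul_of_mem_sup hAB hy
  exact (hAB a ha x hxB).symm.mul_right (hAB x hxA b hb)

end GraphProduct

namespace GraphProduct

variable {V : Type*} {Γ : SimpleGraph V} {G : V → Type*} [∀ v, Group (G v)]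

/-! ### Joins and direct products -/

/-- `S` is the join of two non-empty sets of vertices. -/
def IsJoin (Γ : SimpleGraph V) (S : Set V) : Prop :=
  ∃ R R' : Set V, R.Nonempty ∧ R'.Nonempty ∧ Joined Γ R R' ∧ S = R ∪ R'

theorem subsingleton_or_isJoin {S : Set V} (hS : ¬ IsIrred Γ S) :
    S.Subsingleton ∨ IsJoin Γ S := by
  by_cases h : S.Nontrivial
  · right
    simp only [IsIrred, h, true_and, not_forall, not_not] at hS
    obtain ⟨R, hR, hRne, hSR⟩ := hS
    obtain ⟨x, hx, hxR⟩ := Set.exists_of_ssubset hR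
    refine ⟨R, S \ R, hRne, ⟨x, hx, hxR⟩, fun s hs t ht => ?_,
      (Set.union_sdiff_cancel hR.subset).symm⟩
    exact ((hSR ht.1).resolve_left ht.2) s hs
  · exact Or.inl (Set.not_nontrivial_iff.1 h)

theorem IsIrred.not_isJoin {S : Set V} (hS : IsIrred Γ S) : ¬ IsJoin Γ S := by
  rintro ⟨R, R', hR, ⟨x, hx⟩, hj, rfl⟩
  refine hS.2 R (Set.subset_union_left.ssubset_of_ne fun h => ?_) hR
    (Set.union_subset_union_right _ hj.subset_commonLink)
  have : x ∈ R := by rw [h]; exact Or.inr hx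
  exact Set.disjoint_left.1 hj.disjoint this hx

theorem subset_star_of_joined {S T : Set V} (h : Joined Γ S T) {v : V} (hv : v ∈ S)
    (hS : S ⊆ Γ.vertexStar v) : S ∪ T ⊆ Γ.vertexStar v :=
  Set.union_subset hS fun t ht => Or.inr (h v hv t ht)

theorem ConeFree.left {S T : Set V} (h : ConeFree Γ (S ∪ T)) (hj : Joined Γ S T) :
    ConeFree Γ S :=
  fun v hv hS => h v (Or.inl hv) (subset_star_of_joined hj hv hS)

theorem ConeFree.right {S T : Set V} (h : ConeFree Γ (S ∪ T)) (hj : Joined Γ S T) :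
    ConeFree Γ T :=
  ConeFree.left (Set.union_comm S T ▸ h) hj.symm

/-- If no vertex of `U` is adjacent to all the others, the only decompositions of `⟨U⟩` as a product
of two commuting subgroups are those given by the decompositions of `U` as a join. -/
theorem ConeFree.exists_eq_vertexSubgroup [Finite V] [∀ v, Nontrivial (G v)] {U : Set V}
    (hU : ConeFree Γ U) {A C : Subgroup (GraphProduct Γ G)}
    (hAC : ∀ a ∈ A, ∀ c ∈ C, Commute a c) (hsup : A ⊔ C = vertexSubgroup Γ G U) :
    ∃ I ⊆ U, A = vertexSubgroup Γ G I ∧ C = vertexSubgroup Γ G (U \ I) := by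
  induction U using WellFoundedLT.induction generalizing A C with
  | ind U ih =>
  by_cases hirr : IsIrred Γ U
  · rcases hirr.eq_bot_or_eq_bot hAC hsup with rfl | rfl
    · exact ⟨∅, Set.empty_subset _, by simp, by simpa using hsup⟩
    · exact ⟨U, subset_rfl, by simpa using hsup, by simp⟩
  rcases subsingleton_or_isJoin hirr with hsing | ⟨R, R', hR, hR', hj, rfl⟩
  · rcases hsing.eq_empty_or_singleton with rfl | ⟨v, rfl⟩
    · rw [vertexSubgroup_empty, sup_eq_bot_iff] at hsup
      exact ⟨∅, subset_rfl, by simp [hsup.1], by simp [hsup.2]⟩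
    · exact absurd (show ({v} : Set V) ⊆ Γ.vertexStar v from
        Set.singleton_subset_iff.2 (Set.mem_insert _ _)) (hU v (Set.mem_singleton v))
  have hcomm : ∀ f : GraphProduct Γ G →* GraphProduct Γ G,
      ∀ a ∈ A.map f, ∀ c ∈ C.map f, Commute a c := by
    rintro f _ ⟨a, ha, rfl⟩ _ ⟨c, hc, rfl⟩
    exact (hAC a ha c hc).map f
  have hlt : R < R ∪ R' := by
    refine Set.subset_union_left.ssubset_of_ne fun h => ?_
    obtain ⟨x, hx⟩ := hR'
    exact Set.disjoint_left.1 hj.disjoint (h ▸ Or.inr hx) hx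
  have hlt' : R' < R ∪ R' := by
    refine Set.subset_union_right.ssubset_of_ne fun h => ?_
    obtain ⟨x, hx⟩ := hR
    exact Set.disjoint_left.1 hj.disjoint hx (h ▸ Or.inl hx)
  obtain ⟨I, hI, hAI, hCI⟩ := ih R hlt (hU.left hj) (hcomm (retract Γ G R)) (by
    rw [← Subgroup.map_sup, hsup, map_retract, Set.inter_eq_left.2 Set.subset_union_left])
  obtain ⟨J, hJ, hAJ, hCJ⟩ := ih R' hlt' (hU.right hj) (hcomm (retract Γ G R')) (by
    rw [← Subgroup.map_sup, hsup, map_retract, Set.inter_eq_left.2 Set.subset_union_right])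
  have key : ∀ B : Subgroup (GraphProduct Γ G), B ≤ A ⊔ C → ∀ S S' : Set V,
      B.map (retract Γ G R) = vertexSubgroup Γ G S →
      B.map (retract Γ G R') = vertexSubgroup Γ G S' → B ≤ vertexSubgroup Γ G (S ∪ S') := by
    intro B hB S S' hS hS' b hb
    have hb' : b ∈ vertexSubgroup Γ G (R ∪ R') := hsup ▸ hB hb
    rw [← hj.retract_mul_retract hb', vertexSubgroup_union, ← hS, ← hS']
    exact mul_mem (Subgroup.mem_sup_left ⟨b, hb, rfl⟩) (Subgroup.mem_sup_right ⟨b, hb, rfl⟩)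
  have hA := key A le_sup_left _ _ hAI hAJ
  have hC := key C le_sup_right _ _ hCI hCJ
  have hRR := hj.disjoint
  have hset : R \ I ∪ R' \ J = (R ∪ R') \ (I ∪ J) := by
    ext x
    have h1 : x ∈ R → x ∉ R' := fun h => Set.disjoint_left.1 hRR h
    have h2 := @hI x
    have h3 := @hJ x
    simp only [Set.mem_union, Set.mem_sdiff]
    tauto
  rw [hset] at hC
  have hd : Disjoint (I ∪ J) ((R ∪ R') \ (I ∪ J)) := Set.disjoint_sdiff_right
  have hIJ : I ∪ J ⊆ R ∪ R' := Set.union_subset_union hI hJ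
  refine ⟨I ∪ J, hIJ, le_antisymm hA fun x hx => ?_, le_antisymm hC fun x hx => ?_⟩
  · have hx' := vertexSubgroup_mono hIJ hx
    rw [← hsup] at hx'
    obtain ⟨a, ha, c, hc, rfl⟩ := exists_mul_of_mem_sup hAC hx'
    have h1 := retract_eq_self hx
    rw [map_mul, retract_eq_self (hA ha), retract_eq_one hd (hC hc), mul_one] at h1
    exact h1 ▸ ha
  · have hx' := vertexSubgroup_mono Set.sdiff_subset hx
    rw [← hsup] at hx'
    obtain ⟨a, ha, c, hc, rfl⟩ := exists_mul_of_mem_sup hAC hx'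
    have h1 := retract_eq_self hx
    rw [map_mul, retract_eq_self (hC hc), retract_eq_one hd.symm (hA ha), one_mul] at h1
    exact h1 ▸ hc

/-! ### Graphically irreducible subgroups -/

/-- Recognition of graph products: if a graphically irreducible group is generated by subgroups
indexed by the vertices of a graph, which commute when the vertices are adjacent and have the
universal property of the graph product, then any two distinct vertices carrying non-trivial
subgroups are adjacent. -/
theorem _root_.GraphicallyIrreducible.adj.{u} {A' : Type u} [Group A']
    (hA' : GraphicallyIrreducible A') {A : Type*} [Group A] (e : A' ≃* A)
    {ι : Type*} [Finite ι] (Δ : SimpleGraph ι) (S : ι → Subgroup A)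
    (hcomm : ∀ i j, Δ.Adj i j → ∀ x ∈ S i, ∀ y ∈ S j, Commute x y)
    (hgen : ⨆ i, S i = ⊤)
    (hlift : ∀ (M : Type u) [Group M] (f : ∀ i, S i →* M),
      (∀ i j, Δ.Adj i j → ∀ x y, Commute (f i x) (f j y)) →
      ∃ F : A →* M, ∀ i (x : S i), F x = f i x)
    {i j : ι} (hij : i ≠ j) (hi : S i ≠ ⊥) (hj : S j ≠ ⊥) : Δ.Adj i j := by
  obtain ⟨n, ⟨ε⟩⟩ := Finite.exists_equiv_fin {i // S i ≠ ⊥}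
  -- The vertices are moved to the universe of `A'`, and those with a trivial subgroup are dropped.
  let σ : ULift.{u} (Fin n) → ι := fun k => (ε.symm k.down).1
  have hσ : Injective σ := fun a b h =>
    ULift.down_injective (ε.symm.injective (Subtype.ext h))
  let T : ULift.{u} (Fin n) → Subgroup A' := fun k => (S (σ k)).comap e.toMonoidHom
  have hTn : ∀ k, Nontrivial (T k) := by
    intro k
    obtain ⟨a, ha, ha1⟩ := (S (σ k)).bot_or_exists_ne_one.resolve_left (ε.symm k.down).2
    refine ⟨⟨⟨e.symm a, ?_⟩, 1, fun h => ha1 ?_⟩⟩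
    · show e (e.symm a) ∈ S (σ k)
      rwa [e.apply_symm_apply]
    · have := congrArg (fun z : T k => e z) h
      simpa using this
  let Δ' := Δ.comap σ
  let toA : GraphProduct Δ' (fun k => T k) →* A' := lift (fun k => (T k).subtype) (by
    intro k l h x y
    have := hcomm _ _ h _ x.2 _ y.2
    exact e.injective (by simpa using this.eq))
  have htoA : ∀ k (y : T k), toA (of Δ' (fun k => T k) k y) = y := fun k y => by
    exact lift_of (Γ := Δ') (G := fun k => T k) _ _ k y
  have hex : ∀ i, ∃ f : S i →* GraphProduct Δ' (fun k => T k),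
      ∀ k, σ k = i → ∀ (x : S i) (y : T k), e y = x → f x = of Δ' (fun k => T k) k y := by
    intro i
    by_cases hi : S i = ⊥
    · exact ⟨1, fun k hk => absurd (show S (σ k) = ⊥ by rw [hk, hi]) (ε.symm k.down).2⟩
    have hk : σ ⟨ε ⟨i, hi⟩⟩ = i := by simp [σ]
    refine ⟨(of Δ' (fun k => T k) ⟨ε ⟨i, hi⟩⟩).comp
      ((e.symm.toMonoidHom.comp (S i).subtype).codRestrict (T ⟨ε ⟨i, hi⟩⟩) ?_), ?_⟩
    · intro x
      show e (e.symm x) ∈ S (σ ⟨ε ⟨i, hi⟩⟩)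
      rw [e.apply_symm_apply, hk]
      exact x.2
    · intro k hk' x y hxy
      obtain rfl : k = ⟨ε ⟨i, hi⟩⟩ := hσ (hk'.trans hk.symm)
      rw [MonoidHom.comp_apply]
      congr 1
      refine Subtype.ext ?_
      show e.symm x = y
      rw [← hxy, e.symm_apply_apply]
  choose f hf using hex
  have hf1 : ∀ i, S i = ⊥ → ∀ x, f i x = 1 := by
    intro i hi x
    have : x = 1 := Subtype.ext (by simpa [hi] using x.2)
    rw [this, map_one]
  have hf2 : ∀ i, S i ≠ ⊥ → ∀ x : S i, ∃ k, σ k = i ∧ ∃ y : T k, e y = x ∧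
      f i x = of Δ' (fun k => T k) k y := by
    intro i hi x
    have hk : σ ⟨ε ⟨i, hi⟩⟩ = i := by simp [σ]
    have hx : e.symm x ∈ T ⟨ε ⟨i, hi⟩⟩ := by
      show e (e.symm x) ∈ S (σ ⟨ε ⟨i, hi⟩⟩)
      rw [e.apply_symm_apply, hk]
      exact x.2
    exact ⟨_, hk, ⟨e.symm x, hx⟩, e.apply_symm_apply _,
      hf i _ hk x ⟨e.symm x, hx⟩ (e.apply_symm_apply _)⟩
  obtain ⟨F, hF⟩ := hlift _ f (by
    intro i j hij x y
    by_cases hi : S i = ⊥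
    · rw [hf1 i hi]; exact Commute.one_left _
    by_cases hj : S j = ⊥
    · rw [hf1 j hj]; exact Commute.one_right _
    obtain ⟨k, rfl, a, -, ha⟩ := hf2 i hi x
    obtain ⟨l, rfl, b, -, hb⟩ := hf2 j hj y
    rw [ha, hb]
    exact of_commute (Γ := Δ') (G := fun k => T k) hij a b)
  have h1 : toA.comp (F.comp e.toMonoidHom) = MonoidHom.id A' := by
    have : ∀ a : A, a ∈ (e.toMonoidHom.comp (toA.comp F)).eqLocus (MonoidHom.id A) := by
      intro a
      have ha : a ∈ ⨆ i, S i := hgen ▸ Subgroup.mem_top a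
      suffices hle : ⨆ i, S i ≤ (e.toMonoidHom.comp (toA.comp F)).eqLocus (MonoidHom.id A) from
        hle ha
      refine iSup_le fun i => ?_
      intro x hx
      show e (toA (F x)) = x
      rw [hF i ⟨x, hx⟩]
      by_cases hi : S i = ⊥
      · rw [hf1 i hi, map_one, map_one]
        rw [hi, Subgroup.mem_bot] at hx
        exact hx.symm
      · obtain ⟨k, -, y, hy, hxy⟩ := hf2 i hi ⟨x, hx⟩
        rw [hxy, htoA]
        exact hy
    ext a
    exact e.injective (this (e a))
  have h2 : (F.comp e.toMonoidHom).comp toA = MonoidHom.id _ := by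
    refine MonoidHom.ext fun x => ?_
    refine le_of_forall_of_mem (K := ((F.comp e.toMonoidHom).comp toA).eqLocus (MonoidHom.id _))
      (fun k y => ?_) x
    show F (e (toA (of _ _ k y))) = of _ _ k y
    rw [htoA]
    exact (hF (σ k) ⟨e y, y.2⟩).trans (hf (σ k) k rfl ⟨e y, y.2⟩ y rfl)
  have htop : Δ' = ⊤ := hA' _ Δ' (fun k => T k) ⟨MonoidHom.toMulEquiv _ _ h1 h2⟩
  have hadj : Δ'.Adj ⟨ε ⟨i, hi⟩⟩ ⟨ε ⟨j, hj⟩⟩ := by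
    rw [htop, SimpleGraph.top_adj]
    intro h
    exact hij (congrArg Subtype.val (ε.injective (congrArg ULift.down h)))
  simpa [Δ', σ] using hadj

/-- If a graphically irreducible group `A` retracts onto a copy of `⟨I⟩`, the kernel of the
retraction commuting with this copy, then `I` is a clique, because `A` is a direct product of `⟨I⟩`
and of this kernel. -/
theorem _root_.GraphicallyIrreducible.adj_of_retract [Finite V] [∀ v, Nontrivial (G v)]
    {A' : Type*} [Group A'] (hA' : GraphicallyIrreducible A') {A : Type*} [Group A] (e : A' ≃* A)
    (r : A →* GraphProduct Γ G) (s : GraphProduct Γ G →* A) {I : Set V}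
    (hr : ∀ a, r a ∈ vertexSubgroup Γ G I) (hrs : ∀ x ∈ vertexSubgroup Γ G I, r (s x) = x)
    (hker : ∀ a, r a = 1 → ∀ x ∈ vertexSubgroup Γ G I, Commute a (s x))
    {i j : V} (hi : i ∈ I) (hj : j ∈ I) (hij : i ≠ j) : Γ.Adj i j := by
  classical
  let Δ : SimpleGraph (Option I) :=
    { Adj := fun x y => x ≠ y ∧ ∀ a b : I, x = some a → y = some b → Γ.Adj a b
      symm := ⟨fun x y h => ⟨h.1.symm, fun a b ha hb => (h.2 b a hb ha).symm⟩⟩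
      loopless := ⟨fun x h => h.1 rfl⟩ }
  let S : Option I → Subgroup A := fun x => x.elim r.ker fun i => (s.comp (of Γ G i)).range
  have hSs : ∀ (i : I) (g : G i), s (of Γ G i g) ∈ S (some i) := fun i g => ⟨g, rfl⟩
  have hrem : ∀ a, (s (r a))⁻¹ * a ∈ r.ker := fun a => by
    rw [MonoidHom.mem_ker, map_mul, map_inv, hrs _ (hr a), inv_mul_cancel]
  have hne : ∀ i : I, S (some i) ≠ ⊥ := by
    intro i h
    obtain ⟨g, hg⟩ := exists_ne (1 : G i)
    have h1 := hSs i g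
    rw [h, Subgroup.mem_bot] at h1
    have h2 := hrs _ (of_mem i.2 g)
    rw [h1, map_one] at h2
    exact hg (of_injective _ (h2.symm.trans (map_one _).symm))
  have hadj := hA'.adj e Δ S ?_ ?_ ?_ (i := some ⟨i, hi⟩) (j := some ⟨j, hj⟩)
    (by simpa using hij) (hne _) (hne _)
  · exact hadj.2 _ _ rfl rfl
  · have hns : ∀ i : I, ∀ x ∈ S none, ∀ y ∈ S (some i), Commute x y := by
      rintro i x hx _ ⟨g, rfl⟩
      exact hker x hx _ (of_mem i.2 g)
    rintro (_ | i) (_ | j) h x hx y hy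
    · exact absurd rfl h.1
    · exact hns j x hx y hy
    · exact (hns i y hy x hx).symm
    · obtain ⟨g, rfl⟩ := hx
      obtain ⟨k, rfl⟩ := hy
      exact (of_commute (h.2 i j rfl rfl) g k).map s
  · refine top_le_iff.1 fun a _ => ?_
    have h1 : vertexSubgroup Γ G I ≤ (⨆ i, S i).comap s :=
      vertexSubgroup_le.2 fun v hv g => le_iSup S (some ⟨v, hv⟩) (hSs ⟨v, hv⟩ g)
    have h2 : a = s (r a) * ((s (r a))⁻¹ * a) := by group
    rw [h2]
    exact mul_mem (h1 (hr a)) (le_iSup S none (hrem a))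
  · intro M _ f hf
    let L : GraphProduct Γ G →* M := lift (fun v => if h : v ∈ I then
        (f (some ⟨v, h⟩)).comp ((s.comp (of Γ G v)).codRestrict (S (some ⟨v, h⟩))
          fun g => hSs ⟨v, h⟩ g) else 1) (by
      intro u v h g k
      by_cases hu : u ∈ I <;> by_cases hv : v ∈ I <;> simp only [hu, hv, dif_pos, dif_neg,
        not_false_eq_true, MonoidHom.one_apply, Commute.one_left, Commute.one_right]
      exact hf _ _ ⟨by simpa using h.ne, by
        intro a b ha hb
        simp only [Option.some.injEq] at ha hb
        rw [← ha, ← hb]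
        exact h⟩ _ _)
    have hL : ∀ (i : I) (g : G i), L (of Γ G i g) = f (some i) ⟨s (of Γ G i g), hSs i g⟩ := by
      intro i g
      simp only [L, lift_of]
      rw [dif_pos i.2]
      rfl
    have hLc : ∀ x ∈ vertexSubgroup Γ G I, ∀ y : S none, Commute (L x) (f none y) := by
      intro x hx y
      refine commute_of_forall (fun v hv g => ?_) hx
      have := hL ⟨v, hv⟩ g
      simp only [L, lift_of] at this
      rw [this]
      exact hf _ _ ⟨by simp, by simp⟩ _ _
    let F : A →* M := MonoidHom.mk' (fun a => L (r a) * f none ⟨_, hrem a⟩) (by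
      intro a b
      have h1 : (⟨_, hrem (a * b)⟩ : S none) = ⟨_, hrem a⟩ * ⟨_, hrem b⟩ := by
        refine Subtype.ext ?_
        show (s (r (a * b)))⁻¹ * (a * b) = (s (r a))⁻¹ * a * ((s (r b))⁻¹ * b)
        have h2 := (hker _ (hrem a) _ (inv_mem (hr b))).eq
        rw [map_inv] at h2
        have h3 : (s (r b))⁻¹ * (s (r a))⁻¹ * (a * b) =
            (s (r b))⁻¹ * ((s (r a))⁻¹ * a) * b := by group
        rw [map_mul, map_mul, mul_inv_rev, h3, ← h2, mul_assoc]
      rw [h1, map_mul, map_mul, map_mul, mul_assoc, mul_assoc]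
      congr 1
      rw [← mul_assoc, ← mul_assoc, (hLc _ (hr b) _).eq])
    refine ⟨F, ?_⟩
    rintro (_ | i) ⟨x, hx⟩
    · have hx1 : r x = 1 := hx
      have h1 : L (r x) = 1 := by rw [hx1, map_one]
      have h2 : (⟨_, hrem x⟩ : S none) = ⟨x, hx⟩ := by
        refine Subtype.ext ?_
        show (s (r x))⁻¹ * x = x
        rw [hx1, map_one, inv_one, one_mul]
      exact (congrArg₂ (· * ·) h1 (congrArg (f none) h2)).trans (one_mul _)
    · obtain ⟨g, rfl⟩ := hx
      show L (r (s (of Γ G i g))) * f none _ = _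
      have h1 := hrs _ (of_mem i.2 g)
      rw [h1, hL]
      have h2 : (⟨_, hrem (s (of Γ G i g))⟩ : S none) = 1 := by
        refine Subtype.ext ?_
        show (s (r (s (of Γ G i g))))⁻¹ * s (of Γ G i g) = 1
        rw [h1, inv_mul_cancel]
      have h3 : f none ⟨_, hrem (s (of Γ G i g))⟩ = 1 := by rw [h2, map_one]
      exact (congrArg _ h3).trans (mul_one _)

/-- The projection onto the first factor of an internal direct product which is a parabolic
subgroup. -/
theorem exists_projection {N : Set V} {A C : Subgroup (GraphProduct Γ G)}
    (hAC : ∀ a ∈ A, ∀ c ∈ C, Commute a c) (hdisj : A ⊓ C = ⊥)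
    (hsup : A ⊔ C = vertexSubgroup Γ G N) :
    ∃ q : GraphProduct Γ G →* A, (∀ a : A, q a = a) ∧ (∀ c ∈ C, q c = 1) ∧
      ∀ x ∈ vertexSubgroup Γ G N, (q x : GraphProduct Γ G)⁻¹ * x ∈ C := by
  let ψ := MonoidHom.noncommCoprod A.subtype C.subtype (fun a c => hAC a a.2 c c.2)
  have hψ : ∀ a c, ψ (a, c) = a * c := fun a c => rfl
  have hinj : Injective ψ := by
    rw [injective_iff_map_eq_one]
    rintro ⟨a, c⟩ h
    rw [hψ] at h
    have h1 : (a : GraphProduct Γ G) ∈ A ⊓ C :=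
      ⟨a.2, by rw [mul_eq_one_iff_eq_inv.1 h]; exact C.inv_mem c.2⟩
    rw [hdisj, Subgroup.mem_bot] at h1
    rw [h1, one_mul] at h
    exact Prod.ext (Subtype.ext h1) (Subtype.ext h)
  have hrange : ψ.range = vertexSubgroup Γ G N := by
    have h := MonoidHom.noncommCoprod_range A.subtype C.subtype (fun a c => hAC a a.2 c c.2)
    rw [Subgroup.range_subtype, Subgroup.range_subtype, hsup] at h
    exact h
  let ρ : GraphProduct Γ G →* ψ.range :=
    (retract Γ G N).codRestrict ψ.range fun x => hrange ▸ retract_mem N x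
  let q : GraphProduct Γ G →* A :=
    (MonoidHom.fst A C).comp ((MonoidHom.ofInjective hinj).symm.toMonoidHom.comp ρ)
  have hq : ∀ a c, q (ψ (a, c)) = a := by
    intro a c
    have h1 : ρ (ψ (a, c)) = MonoidHom.ofInjective hinj (a, c) := by
      refine Subtype.ext ?_
      show retract Γ G N (ψ (a, c)) = ψ (a, c)
      exact retract_eq_self (hrange ▸ ⟨(a, c), rfl⟩)
    show ((MonoidHom.ofInjective hinj).symm (ρ (ψ (a, c)))).1 = a
    rw [h1, MulEquiv.symm_apply_apply]
  refine ⟨q, fun a => ?_, fun c hc => ?_, fun x hx => ?_⟩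
  · simpa [hψ] using hq a 1
  · simpa [hψ] using hq 1 ⟨c, hc⟩
  · rw [← hrange] at hx
    obtain ⟨⟨a, c⟩, rfl⟩ := hx
    rw [hq, hψ, inv_mul_cancel_left]
    exact c.2

/-- A graphically irreducible direct factor of `⟨K⟩ × ⟨U⟩` is contained in `⟨K⟩` when no vertex of
`U` is adjacent to all the other vertices of `U`. -/
theorem _root_.GraphicallyIrreducible.le_vertexSubgroup [Finite V] [∀ v, Nontrivial (G v)]
    {A' : Type*} [Group A'] (hA' : GraphicallyIrreducible A')
    {A C : Subgroup (GraphProduct Γ G)} (e : A' ≃* A)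
    (hAC : ∀ a ∈ A, ∀ c ∈ C, Commute a c) (hdisj : A ⊓ C = ⊥) {K U : Set V}
    (hKU : Joined Γ K U) (hU : ConeFree Γ U) (hsup : A ⊔ C = vertexSubgroup Γ G (K ∪ U)) :
    A ≤ vertexSubgroup Γ G K := by
  have hmap : A.map (retract Γ G U) ⊔ C.map (retract Γ G U) = vertexSubgroup Γ G U := by
    rw [← Subgroup.map_sup, hsup, map_retract, Set.inter_eq_left.2 Set.subset_union_right]
  have hmapc : ∀ a ∈ A.map (retract Γ G U), ∀ c ∈ C.map (retract Γ G U), Commute a c := by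
    rintro _ ⟨a, ha, rfl⟩ _ ⟨c, hc, rfl⟩
    exact (hAC a ha c hc).map _
  obtain ⟨I, hIU, hAI, hCI⟩ := hU.exists_eq_vertexSubgroup hmapc hmap
  have hAN : A ≤ vertexSubgroup Γ G (K ∪ U) := hsup ▸ le_sup_left
  suffices hI : I = ∅ by
    intro a ha
    have h1 : retract Γ G U a = 1 := by
      have : retract Γ G U a ∈ A.map (retract Γ G U) := ⟨a, ha, rfl⟩
      rwa [hAI, hI, vertexSubgroup_empty, Subgroup.mem_bot] at this
    rw [← hKU.retract_mul_retract (hAN ha), h1, mul_one]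
    exact retract_mem _ _
  by_contra hne
  obtain ⟨i, hi⟩ := Set.nonempty_iff_ne_empty.2 hne
  have hjoin : Joined Γ I (U \ I) := by
    intro s hs t ht
    obtain ⟨g, hg⟩ := exists_ne (1 : G s)
    obtain ⟨k, hk⟩ := exists_ne (1 : G t)
    exact adj_of_commute (fun h => ht.2 (h ▸ hs)) hg hk
      (hmapc _ (hAI ▸ of_mem hs g) _ (hCI ▸ of_mem ht k))
  obtain ⟨j, hj, hij⟩ : ∃ j ∈ I, j ∉ Γ.vertexStar i := by
    by_contra! h
    refine hU i (hIU hi) ?_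
    have := subset_star_of_joined hjoin hi h
    rwa [Set.union_sdiff_cancel hIU] at this
  have hjoin' : Joined Γ I (K ∪ U \ I) := by
    rintro s hs t (ht | ht)
    · exact (hKU t ht s (hIU hs)).symm
    · exact hjoin s hs t ht
  have hN : I ∪ (K ∪ U \ I) = K ∪ U := by
    rw [← Set.union_assoc, Set.union_comm I K, Set.union_assoc, Set.union_sdiff_cancel hIU]
  obtain ⟨q, hqA, hqC, hq⟩ := exists_projection hAC hdisj hsup
  have hIN : vertexSubgroup Γ G I ≤ vertexSubgroup Γ G (K ∪ U) :=
    vertexSubgroup_mono (hIU.trans Set.subset_union_right)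
  have hadj := hA'.adj_of_retract e ((retract Γ G I).comp A.subtype) q (I := I)
    (fun a => retract_mem _ _) ?_ ?_ hi hj (fun h => hij (Or.inl h.symm))
  · exact hij (Or.inr hadj)
  · intro x hx
    have h1 := hq x (hIN hx)
    have h2 : retract Γ G I ((q x : GraphProduct Γ G)⁻¹ * x) = 1 := by
      have h3 : retract Γ G U ((q x : GraphProduct Γ G)⁻¹ * x) ∈ vertexSubgroup Γ G (U \ I) :=
        hCI ▸ ⟨_, h1, rfl⟩
      have h4 := retract_eq_one (S := I) Set.disjoint_sdiff_right h3
      rwa [retract_retract, Set.inter_eq_left.2 hIU] at h4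
    rw [map_mul, map_inv, retract_eq_self hx, inv_mul_eq_one] at h2
    exact h2
  · intro a ha x hx
    have h1 := hjoin'.retract_mul_retract (hN.symm ▸ hAN a.2)
    have ha' : retract Γ G I a = 1 := ha
    rw [ha', one_mul] at h1
    have h2 : Commute (a : GraphProduct Γ G) x := by
      rw [← h1]
      exact (hjoin'.commute hx (retract_mem _ _)).symm
    have h3 := h2.map q
    rwa [hqA] at h3

end GraphProduct

/-! ### Subgroups of free products containing a free factor -/

theorem Monoid.CoprodI.lift_of_comp_injective {ι : Type*} {M N : ι → Type*} [∀ i, Group (M i)]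
    [∀ i, Group (N i)] (f : ∀ i, M i →* N i) (hf : ∀ i, Injective (f i)) :
    Injective (Monoid.CoprodI.lift fun i => (Monoid.CoprodI.of (M := N)).comp (f i)) := by
  classical
  rw [injective_iff_map_eq_one]
  intro x hx
  obtain ⟨w, rfl⟩ := (Monoid.CoprodI.Word.equiv (M := M)).symm.surjective x
  let w' : Monoid.CoprodI.Word N :=
    { toList := w.toList.map fun l => ⟨l.1, f l.1 l.2⟩
      ne_one := by
        intro l hl
        obtain ⟨l', hl', rfl⟩ := List.mem_map.1 hl
        exact fun h => w.ne_one l' hl' (hf _ (h.trans (map_one _).symm))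
      chain_ne := by
        rw [List.isChain_map]
        exact w.chain_ne }
  have h1 : Monoid.CoprodI.lift (fun i => (Monoid.CoprodI.of (M := N)).comp (f i)) w.prod =
      w'.prod := by
    simp [w', Monoid.CoprodI.Word.prod, map_list_prod, Function.comp_def]
  have h2 : w'.prod = (Monoid.CoprodI.Word.empty : Monoid.CoprodI.Word N).prod := by
    rw [← h1]
    exact hx
  have h3 : w' = Monoid.CoprodI.Word.empty := Monoid.CoprodI.Word.equiv.symm.injective h2
  have h4 : w.toList = [] := by
    have := congrArg Monoid.CoprodI.Word.toList h3
    simpa [w'] using this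
  have h5 : w = Monoid.CoprodI.Word.empty := Monoid.CoprodI.Word.ext h4
  rw [h5]
  rfl

theorem Subgroup.smul_one_coe_eq_iff {M : Type*} [Group M] {A : Subgroup M} {g : M} :
    g • ((1 : M) : M ⧸ A) = ((1 : M) : M ⧸ A) ↔ g ∈ A := by
  rw [MulAction.Quotient.smul_coe, eq_comm, QuotientGroup.eq]
  simp

namespace GraphProduct

variable {V : Type*} {Γ : SimpleGraph V} {G : V → Type*} [∀ v, Group (G v)]

theorem map_cocycle {X K M : Type*} [Group K] [Group M] (α : GraphProduct Γ G →* Equiv.Perm X)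
    (c : ∀ w, G w → X → K)
    (hc : ∀ w g h x, c w (g * h) x = c w g (α (of Γ G w h) x) * c w h x)
    (hcomm : ∀ u w, Γ.Adj u w → ∀ g k x,
      c u g (α (of Γ G w k) x) * c w k x = c w k (α (of Γ G u g) x) * c u g x)
    (p : K →* M) (ψ : GraphProduct Γ G →* M) (h : ∀ w g x, p (c w g x) = ψ (of Γ G w g))
    (g : GraphProduct Γ G) (x : X) : p (cocycle α c hc hcomm g x) = ψ g := by
  let T : Subgroup (GraphProduct Γ G) :=
    { carrier := {g | ∀ x, p (cocycle α c hc hcomm g x) = ψ g}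
      one_mem' := fun x => by rw [cocycle_one, map_one, map_one]
      mul_mem' := fun ha hb x => by rw [cocycle_mul, map_mul, map_mul, ha, hb]
      inv_mem' := fun {a} ha x => by
        have h := congrArg p (cocycle_mul α c hc hcomm a a⁻¹ x)
        rw [mul_inv_cancel, cocycle_one, map_one, map_mul, ha] at h
        rw [map_inv]
        exact (inv_eq_of_mul_eq_one_right h.symm).symm }
  exact le_of_forall_of_mem (K := T) (fun w g x => by rw [cocycle_of, h]) g x

/-- Let `⟨N₀ ∪ N₁⟩` act on `X`, the subgroup `⟨N₀⟩` fixing `x₀`. The cocycle obtained by reading an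
element as a path in `X` and by putting into the first factor the letters in `⟨N₀⟩` read at `x₀`,
and all the other letters into the second factor. -/
theorem exists_split_cocycle {X K : Type*} [Group K] (inc : Bool → GraphProduct Γ G →* K)
    (fold : K →* GraphProduct Γ G) (hfold : ∀ b g, fold (inc b g) = g)
    {N₀ N₁ : Set V} (hd : Disjoint N₀ N₁) (hN : ∀ p ∈ N₀, ∀ q ∈ N₁, ¬ Γ.Adj p q)
    (α : GraphProduct Γ G →* Equiv.Perm X) (x₀ : X)
    (hα₀ : ∀ w ∈ N₀, ∀ g x, α (of Γ G w g) x = x₀ ↔ x = x₀)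
    (hα₁ : ∀ w, w ∉ N₀ → w ∉ N₁ → ∀ g x, α (of Γ G w g) x = x) :
    ∃ κ : GraphProduct Γ G → X → K,
      (∀ g h x, κ (g * h) x = κ g (α h x) * κ h x) ∧ (∀ x, κ 1 x = 1) ∧
      (∀ w ∈ N₀, ∀ g, κ (of Γ G w g) x₀ = inc true (of Γ G w g)) ∧
      (∀ w ∈ N₀, ∀ g x, x ≠ x₀ → κ (of Γ G w g) x = inc false (of Γ G w g)) ∧
      (∀ w ∈ N₁, ∀ g x, κ (of Γ G w g) x = inc false (of Γ G w g)) ∧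
      ∀ g x, fold (κ g x) = retract Γ G (N₀ ∪ N₁) g := by
  classical
  let c : ∀ w, G w → X → K := fun w g x =>
    if w ∈ N₀ then (if x = x₀ then inc true (of Γ G w g) else inc false (of Γ G w g))
    else if w ∈ N₁ then inc false (of Γ G w g) else 1
  have hc0 : ∀ w ∈ N₀, ∀ g, c w g x₀ = inc true (of Γ G w g) := by
    intro w hw g
    simp only [c, if_pos hw, if_true]
  have hc0' : ∀ w ∈ N₀, ∀ g x, x ≠ x₀ → c w g x = inc false (of Γ G w g) := by
    intro w hw g x hx
    simp only [c, if_pos hw, if_neg hx]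
  have hc1 : ∀ w ∈ N₁, ∀ g x, c w g x = inc false (of Γ G w g) := by
    intro w hw g x
    simp only [c, if_neg (Set.disjoint_right.1 hd hw), if_pos hw]
  have hc2 : ∀ w, w ∉ N₀ → w ∉ N₁ → ∀ g x, c w g x = 1 := by
    intro w h0 h1 g x
    simp only [c, if_neg h0, if_neg h1]
  clear_value c
  have hc : ∀ w g h x, c w (g * h) x = c w g (α (of Γ G w h) x) * c w h x := by
    intro w g h x
    by_cases h0 : w ∈ N₀
    · by_cases hx : x = x₀
      · subst hx
        rw [(hα₀ w h0 h x).2 rfl, hc0 w h0, hc0 w h0, hc0 w h0, map_mul, map_mul]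
      · have hx' : α (of Γ G w h) x ≠ x₀ := fun h' => hx ((hα₀ w h0 h x).1 h')
        rw [hc0' w h0 _ _ hx, hc0' w h0 _ _ hx, hc0' w h0 _ _ hx', map_mul, map_mul]
    · by_cases h1 : w ∈ N₁
      · rw [hc1 w h1, hc1 w h1, hc1 w h1, map_mul, map_mul]
      · rw [hc2 w h0 h1, hc2 w h0 h1, hc2 w h0 h1, one_mul]
  have hcomm : ∀ u w, Γ.Adj u w → ∀ g k x,
      c u g (α (of Γ G w k) x) * c w k x = c w k (α (of Γ G u g) x) * c u g x := by
    intro u w huw g k x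
    have hof : ∀ b, inc b (of Γ G u g) * inc b (of Γ G w k) =
        inc b (of Γ G w k) * inc b (of Γ G u g) := fun b =>
      ((of_commute huw g k).map (inc b)).eq
    by_cases hu0 : u ∈ N₀
    · by_cases hw0 : w ∈ N₀
      · by_cases hx : x = x₀
        · subst hx
          rw [(hα₀ u hu0 g x).2 rfl, (hα₀ w hw0 k x).2 rfl, hc0 u hu0, hc0 w hw0, hof]
        · have hxu : α (of Γ G u g) x ≠ x₀ := fun h' => hx ((hα₀ u hu0 g x).1 h')
          have hxw : α (of Γ G w k) x ≠ x₀ := fun h' => hx ((hα₀ w hw0 k x).1 h')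
          rw [hc0' u hu0 _ _ hx, hc0' u hu0 _ _ hxw, hc0' w hw0 _ _ hx, hc0' w hw0 _ _ hxu, hof]
      · have hw1 : w ∉ N₁ := fun h => hN u hu0 w h huw
        rw [hα₁ w hw0 hw1, hc2 w hw0 hw1, hc2 w hw0 hw1, one_mul, mul_one]
    by_cases hw0 : w ∈ N₀
    · have hu1 : u ∉ N₁ := fun h => hN w hw0 u h huw.symm
      rw [hα₁ u hu0 hu1, hc2 u hu0 hu1, hc2 u hu0 hu1, one_mul, mul_one]
    by_cases hu1 : u ∈ N₁ <;> by_cases hw1 : w ∈ N₁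
    · rw [hc1 u hu1, hc1 w hw1, hc1 u hu1, hc1 w hw1, hof]
    · rw [hc2 w hw0 hw1, hc2 w hw0 hw1, hc1 u hu1, hc1 u hu1, one_mul, mul_one]
    · rw [hc2 u hu0 hu1, hc2 u hu0 hu1, hc1 w hw1, hc1 w hw1, one_mul, mul_one]
    · rw [hc2 u hu0 hu1, hc2 u hu0 hu1, hc2 w hw0 hw1, hc2 w hw0 hw1]
  refine ⟨cocycle α c hc hcomm, cocycle_mul α c hc hcomm, cocycle_one α c hc hcomm,
    fun w hw g => ?_, fun w hw g x hx => ?_, fun w hw g x => ?_, fun g x => ?_⟩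
  · rw [cocycle_of, hc0 w hw]
  · rw [cocycle_of, hc0' w hw _ _ hx]
  · rw [cocycle_of, hc1 w hw]
  · refine map_cocycle α c hc hcomm fold _ (fun w g x => ?_) g x
    by_cases h0 : w ∈ N₀
    · rw [retract_of_mem (S := N₀ ∪ N₁) (Or.inl h0) g]
      by_cases hx : x = x₀
      · rw [hx, hc0 w h0, hfold]
      · rw [hc0' w h0 _ _ hx, hfold]
    · by_cases h1 : w ∈ N₁
      · rw [hc1 w h1, hfold, retract_of_mem (S := N₀ ∪ N₁) (Or.inr h1) g]
      · rw [hc2 w h0 h1, map_one, retract_of_not_mem (by simp [h0, h1]) g]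

/-- The action on the cosets of `A` through the retraction onto `⟨N₀ ∪ N₁⟩`. The base point has
stabiliser `A` in `⟨N₀ ∪ N₁⟩`, and in particular it is fixed by `⟨N₀⟩`. -/
theorem exists_stabilizer {N₀ N₁ : Set V} {A : Subgroup (GraphProduct Γ G)}
    (hle : vertexSubgroup Γ G N₀ ≤ A) :
    ∃ (α : GraphProduct Γ G →* Equiv.Perm (GraphProduct Γ G ⧸ A)) (x₀ : GraphProduct Γ G ⧸ A),
      (∀ g ∈ vertexSubgroup Γ G (N₀ ∪ N₁), α g x₀ = x₀ ↔ g ∈ A) ∧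
      (∀ w ∈ N₀, ∀ g x, α (of Γ G w g) x = x₀ ↔ x = x₀) ∧
      ∀ w, w ∉ N₀ → w ∉ N₁ → ∀ g x, α (of Γ G w g) x = x := by
  let α := (MulAction.toPermHom (GraphProduct Γ G) (GraphProduct Γ G ⧸ A)).comp
    (retract Γ G (N₀ ∪ N₁))
  have hα : ∀ g x, α g x = retract Γ G (N₀ ∪ N₁) g • x := fun g x => rfl
  refine ⟨α, ((1 : GraphProduct Γ G) : GraphProduct Γ G ⧸ A), fun g hg => ?_,
    fun w hw g x => ?_, fun w h0 h1 g x => ?_⟩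
  · rw [hα, retract_eq_self hg]
    exact Subgroup.smul_one_coe_eq_iff
  · rw [hα, retract_of_mem (S := N₀ ∪ N₁) (Or.inl hw)]
    have h1 := Subgroup.smul_one_coe_eq_iff.2 (hle (of_mem hw g))
    refine ⟨fun h => smul_left_cancel (of Γ G w g) (h.trans h1.symm), fun h => by rw [h, h1]⟩
  · rw [hα, retract_of_not_mem (by simp [h0, h1]), one_smul]

/-- Let `A` be a graphically irreducible subgroup of the free product of `⟨N₀⟩` and `⟨N₁⟩`. If `A`
contains `⟨N₀⟩`, then `A = ⟨N₀⟩`. Indeed `A` is the free product of `⟨N₀⟩` and of the subgroup of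
the elements of `A` which, read as paths from the base point in the set of cosets of `A`, never use
a letter in `⟨N₀⟩` at the base point. -/
theorem _root_.GraphicallyIrreducible.eq_vertexSubgroup {A' : Type*} [Group A']
    (hA' : GraphicallyIrreducible A') {A : Subgroup (GraphProduct Γ G)} (e : A' ≃* A)
    {N₀ N₁ : Set V} (hd : Disjoint N₀ N₁) (hN : ∀ p ∈ N₀, ∀ q ∈ N₁, ¬ Γ.Adj p q)
    (hle : vertexSubgroup Γ G N₀ ≤ A) (hA : A ≤ vertexSubgroup Γ G (N₀ ∪ N₁))
    (hne : vertexSubgroup Γ G N₀ ≠ ⊥) : A = vertexSubgroup Γ G N₀ := by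
  let inc : Bool → GraphProduct Γ G →* Monoid.CoprodI fun _ : Bool => GraphProduct Γ G := fun b =>
    (Monoid.CoprodI.of (M := fun _ : Bool => GraphProduct Γ G) (i := b))
  let fold : (Monoid.CoprodI fun _ : Bool => GraphProduct Γ G) →* GraphProduct Γ G :=
    Monoid.CoprodI.lift fun _ => MonoidHom.id _
  have hfold : ∀ b g, fold (inc b g) = g := fun b g => Monoid.CoprodI.lift_of _ _
  obtain ⟨α, x₀, hαA, hα₀, hα₁⟩ := exists_stabilizer (N₁ := N₁) hle
  obtain ⟨κ, hκmul, hκone, hκ0, hκ0', hκ1, hfoldκ⟩ :=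
    exists_split_cocycle inc fold hfold hd hN α x₀ hα₀ hα₁
  let θ : A →* Monoid.CoprodI fun _ : Bool => GraphProduct Γ G :=
    { toFun := fun a => κ a x₀
      map_one' := hκone x₀
      map_mul' := fun a b => by
        rw [Subgroup.coe_mul, hκmul, (hαA b (hA b.2)).2 b.2] }
  have hθ₀ : ∀ b ∈ vertexSubgroup Γ G N₀, κ b x₀ = inc true b := by
    let T : Subgroup (GraphProduct Γ G) :=
      { carrier := {b | α b x₀ = x₀ ∧ κ b x₀ = inc true b}
        one_mem' := ⟨by simp, by rw [hκone, map_one]⟩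
        mul_mem' := fun {a b} ha hb => ⟨by rw [map_mul, Equiv.Perm.mul_apply, hb.1, ha.1],
          by rw [hκmul, hb.1, ha.2, hb.2, map_mul]⟩
        inv_mem' := fun {a} ha => by
          have h1 : α a⁻¹ x₀ = x₀ := by rw [map_inv, Equiv.Perm.inv_eq_iff_eq]; exact ha.1.symm
          refine ⟨h1, ?_⟩
          have h2 := hκmul a a⁻¹ x₀
          rw [mul_inv_cancel, hκone, h1, ha.2] at h2
          rw [map_inv]
          exact (inv_eq_of_mul_eq_one_right h2.symm).symm }
    have hT : vertexSubgroup Γ G N₀ ≤ T := vertexSubgroup_le.2 fun w hw g =>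
      ⟨(hα₀ w hw g x₀).2 rfl, hκ0 w hw g⟩
    exact fun b hb => (hT hb).2
  let S : Bool → Subgroup A := fun b =>
    cond b ((vertexSubgroup Γ G N₀).subgroupOf A) ((inc false).range.comap θ)
  have hinc : ∀ b (s : S b), θ s = inc b s := by
    rintro (_ | _) ⟨s, hs⟩
    · obtain ⟨y, hy⟩ : ∃ y, inc false y = θ s := hs
      have h1 := hfoldκ s x₀
      rw [show κ s x₀ = θ s from rfl, ← hy, hfold,
        retract_eq_self (hA s.2)] at h1
      rw [h1] at hy
      exact hy.symm
    · exact hθ₀ s hs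
  have hgen : ⨆ b, S b = ⊤ := by
    let D : Subgroup (GraphProduct Γ G) := (⨆ b, S b).map A.subtype
    have hDA : D ≤ A := by
      rintro _ ⟨d, -, rfl⟩
      exact d.2
    have hSD : ∀ b (s : A), s ∈ S b → (s : GraphProduct Γ G) ∈ D := fun b s hs =>
      ⟨s, le_iSup S b hs, rfl⟩
    -- Letters being read from the right, `d` is the part of the path up to the last letter of `⟨N₀⟩`
    -- which is read at the base point, and `r` is the remaining part.
    let P : GraphProduct Γ G → Prop := fun g => ∃ r d, g = r * d ∧ d ∈ D ∧
      r ∈ vertexSubgroup Γ G (N₀ ∪ N₁) ∧ κ r x₀ ∈ (inc false).range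
    have hfalse : ∀ r, (hr : r ∈ A) → κ r x₀ ∈ (inc false).range → r ∈ D := fun r hr h =>
      hSD false ⟨r, hr⟩ h
    have hletter : ∀ w ∈ N₀ ∪ N₁, ∀ k g, P g → P (of Γ G w k * g) := by
      rintro w hw k _ ⟨r, d, rfl, hd, hr, hκ⟩
      by_cases h : w ∈ N₀ ∧ α r x₀ = x₀
      · have hrA := (hαA r hr).1 h.2
        have hwD : of Γ G w k ∈ D :=
          hSD true ⟨_, hle (of_mem h.1 k)⟩ (of_mem h.1 k)
        exact ⟨1, of Γ G w k * (r * d), (one_mul _).symm,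
          mul_mem hwD (mul_mem (hfalse r hrA hκ) hd), one_mem _, hκone x₀ ▸ one_mem _⟩
      · refine ⟨of Γ G w k * r, d, (mul_assoc _ _ _).symm, hd, mul_mem (of_mem hw k) hr, ?_⟩
        rw [hκmul]
        refine mul_mem ?_ hκ
        have h1 : κ (of Γ G w k) (α r x₀) = inc false (of Γ G w k) := by
          rcases hw with hw | hw
          · exact hκ0' w hw k _ fun h' => h ⟨hw, h'⟩
          · exact hκ1 w hw k _
        exact ⟨_, h1.symm⟩
    let T : Subgroup (GraphProduct Γ G) :=
      { carrier := {x | (∀ g, P g → P (x * g)) ∧ ∀ g, P g → P (x⁻¹ * g)}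
        one_mem' := by simp
        mul_mem' := fun {a b} ha hb =>
          ⟨fun g hg => by rw [mul_assoc]; exact ha.1 _ (hb.1 g hg),
            fun g hg => by rw [mul_inv_rev, mul_assoc]; exact hb.2 _ (ha.2 g hg)⟩
        inv_mem' := fun {a} ha => ⟨ha.2, by simpa using ha.1⟩ }
    have hT : vertexSubgroup Γ G (N₀ ∪ N₁) ≤ T := vertexSubgroup_le.2 fun w hw k =>
      ⟨hletter w hw k, by rw [← map_inv]; exact hletter w hw k⁻¹⟩
    refine top_le_iff.1 fun a _ => ?_
    obtain ⟨r, d, hrd, hdD, hr, hκ⟩ : P (a * 1) :=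
      (hT (hA a.2)).1 1 ⟨1, 1, (one_mul _).symm, one_mem _, one_mem _, hκone x₀ ▸ one_mem _⟩
    have hrA : r ∈ A := by
      rw [mul_one] at hrd
      rw [eq_mul_inv_of_mul_eq hrd.symm]
      exact mul_mem a.2 (inv_mem (hDA hdD))
    have haD : (a : GraphProduct Γ G) ∈ D := by
      rw [mul_one] at hrd
      rw [hrd]
      exact mul_mem (hfalse r hrA hκ) hdD
    obtain ⟨a', ha', h⟩ := haD
    exact (Subtype.ext h : a' = a) ▸ ha'
  let m : Monoid.CoprodI (fun b => S b) →*
      Monoid.CoprodI fun _ : Bool => GraphProduct Γ G := Monoid.CoprodI.lift fun b =>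
    (Monoid.CoprodI.of (M := fun _ : Bool => GraphProduct Γ G) (i := b)).comp
      (A.subtype.comp (S b).subtype)
  have hm : Injective m := Monoid.CoprodI.lift_of_comp_injective
    (N := fun _ : Bool => GraphProduct Γ G) (fun b => A.subtype.comp (S b).subtype)
    fun b => (A.subtype_injective).comp (S b).subtype_injective
  have hmof : ∀ b (s : S b), m (Monoid.CoprodI.of s) = inc b s := fun b s =>
    Monoid.CoprodI.lift_of _ _
  have hθm : ∀ a, θ a ∈ m.range := by
    intro a
    have h1 : ⨆ b, S b ≤ m.range.comap θ := iSup_le fun b s hs =>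
      ⟨Monoid.CoprodI.of ⟨s, hs⟩, (hmof b ⟨s, hs⟩).trans (hinc b ⟨s, hs⟩).symm⟩
    exact h1 (hgen ▸ Subgroup.mem_top a)
  have hadj : ¬ (⊥ : SimpleGraph Bool).Adj true false := by simp
  have hSt : S true ≠ ⊥ := by
    intro h
    apply hne
    have h1 : (vertexSubgroup Γ G N₀).subgroupOf A = ⊥ := h
    rw [Subgroup.subgroupOf_eq_bot, disjoint_iff, inf_eq_left.2 hle] at h1
    exact h1
  have hSf : S false = ⊥ := by
    by_contra hSf
    refine hadj (hA'.adj e ⊥ S (by simp) hgen (fun M _ f _ => ?_) (by simp) hSt hSf)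
    refine ⟨(Monoid.CoprodI.lift f).comp ((MonoidHom.ofInjective hm).symm.toMonoidHom.comp
      (θ.codRestrict m.range hθm)), fun b s => ?_⟩
    have h1 : θ.codRestrict m.range hθm s = MonoidHom.ofInjective hm (Monoid.CoprodI.of s) := by
      refine Subtype.ext ?_
      show θ s = m (Monoid.CoprodI.of s)
      rw [hinc, hmof]
    show Monoid.CoprodI.lift f ((MonoidHom.ofInjective hm).symm
      (θ.codRestrict m.range hθm s)) = f b s
    rw [h1, MulEquiv.symm_apply_apply, Monoid.CoprodI.lift_of]
  rw [iSup_bool_eq, hSf, sup_bot_eq] at hgen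
  have h1 : (vertexSubgroup Γ G N₀).subgroupOf A = ⊤ := hgen
  exact le_antisymm (Subgroup.subgroupOf_eq_top.1 h1) hle

end GraphProduct

/-! ### Stars and maximal vertices -/

namespace SimpleGraph

variable {V : Type*} {Γ : SimpleGraph V}

theorem Prec.refl (u : V) : Γ.Prec u u := Set.subset_insert _ _

theorem Prec.trans {u v w : V} (huv : Γ.Prec u v) (hvw : Γ.Prec v w) : Γ.Prec u w := by
  intro x hx
  rcases huv hx with rfl | h
  · rcases hvw (Γ.adj_symm hx) with rfl | h1
    · exact Or.inr hx
    · rcases huv (Γ.adj_symm h1) with rfl | h2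
      · exact Or.inl rfl
      · exact Or.inr (Γ.adj_symm h2)
  · exact hvw h

theorem mem_precClass (u : V) : u ∈ Γ.precClass u := ⟨Prec.refl u, Prec.refl u⟩

theorem precClass_eq {u v : V} (h : v ∈ Γ.precClass u) : Γ.precClass v = Γ.precClass u := by
  ext w
  exact ⟨fun hw => ⟨h.1.trans hw.1, hw.2.trans h.2⟩, fun hw => ⟨h.2.trans hw.1, hw.2.trans h.1⟩⟩

theorem exists_isPrecMaximal [Finite V] (v : V) : ∃ w, Γ.Prec v w ∧ Γ.IsPrecMaximal w := by
  let _ : Preorder V :=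
    { le := Γ.Prec
      le_refl := Prec.refl
      le_trans := fun _ _ _ => Prec.trans }
  obtain ⟨w, hvw, hw⟩ := (Set.toFinite (Set.univ : Set V)).exists_le_maximal (Set.mem_univ v)
  exact ⟨w, hvw, fun x hx => hw.2 (Set.mem_univ x) hx⟩

/-- If two adjacent vertices are comparable, they are equivalent to each other by maximality, and
hence have the same star. -/
theorem IsPrecMaximal.not_prec_of_adj {u : V} (hu : Γ.IsPrecMaximal u)
    (hΓ : ∀ v v' : V, v ≠ v' → Γ.vertexStar v ≠ Γ.vertexStar v') {p : V} (hp : Γ.Adj u p) :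
    ¬ Γ.Prec u p := by
  intro h
  refine hΓ u p hp.ne (Set.Subset.antisymm ?_ ?_)
  · exact Set.insert_subset (Or.inr hp.symm) h
  · exact Set.insert_subset (Or.inr hp) (hu p h)

variable {u : V}

theorem not_adj_of_mem_precClass (hadj : ∀ p, Γ.Adj u p → ¬ Γ.Prec u p) {v : V}
    (hv : v ∈ Γ.precClass u) : ¬ Γ.Adj u v :=
  fun h => hadj v h hv.1

theorem joined_precClass (hadj : ∀ p, Γ.Adj u p → ¬ Γ.Prec u p) :
    GraphProduct.Joined Γ (Γ.precClass u) (Γ.neighborSet u) := by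
  intro v hv x hx
  rcases hv.1 hx with rfl | h
  · exact absurd hx (not_adj_of_mem_precClass hadj hv)
  · exact h

theorem commonLink_precClass (hadj : ∀ p, Γ.Adj u p → ¬ Γ.Prec u p) :
    GraphProduct.commonLink Γ (Γ.precClass u) = Γ.neighborSet u :=
  Set.Subset.antisymm (fun _ hx => hx u (mem_precClass u)) (joined_precClass hadj).subset_commonLink

theorem coneFree_neighborSet (hadj : ∀ p, Γ.Adj u p → ¬ Γ.Prec u p) :
    GraphProduct.ConeFree Γ (Γ.neighborSet u) :=
  fun p hp h => hadj p hp h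

theorem IsPrecMaximal.commonLink_subset (hu : Γ.IsPrecMaximal u) {S : Set V}
    (hS : Γ.neighborSet u ⊆ S) : GraphProduct.commonLink Γ S ⊆ Γ.precClass u := by
  intro x hx
  have h : Γ.Prec u x := fun y hy => Or.inr (hx y (hS hy)).symm
  exact ⟨h, hu x h⟩

end SimpleGraph

namespace GraphProduct

variable {V : Type*} {Γ : SimpleGraph V} {G : V → Type*} [∀ v, Group (G v)]
variable {W : Type*} {Δ : SimpleGraph W} {H : W → Type*} [∀ w, Group (H w)]

/-! ### Morphisms between graph products of graphically irreducible groups -/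

theorem vertexSubgroup_singleton (v : V) : vertexSubgroup Γ G {v} = (of Γ G v).range := by
  simp [vertexSubgroup]

/-- A vertex-group is isomorphic to its image under a morphism which is injective on it. -/
theorem nonempty_equiv_map {M : Type*} [Group M] {f : GraphProduct Γ G →* M} {N : Set V}
    (hf : Set.InjOn f (vertexSubgroup Γ G N)) {t : V} (ht : t ∈ N) :
    Nonempty (G t ≃* (vertexSubgroup Γ G {t}).map f) := by
  have hinj : Injective (f.comp (of Γ G t)) := fun a b h =>
    of_injective t (hf (of_mem ht a) (of_mem ht b) h)
  have hrange : (f.comp (of Γ G t)).range = (vertexSubgroup Γ G {t}).map f := by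
    rw [MonoidHom.range_comp, vertexSubgroup_singleton]
  exact ⟨(MonoidHom.ofInjective hinj).trans (MulEquiv.subgroupCongr hrange)⟩

theorem map_vertexSubgroup_union {M : Type*} [Group M] (f : GraphProduct Γ G →* M) (S T : Set V) :
    (vertexSubgroup Γ G S).map f ⊔ (vertexSubgroup Γ G T).map f =
      (vertexSubgroup Γ G (S ∪ T)).map f := by
  rw [vertexSubgroup_union, Subgroup.map_sup]

theorem Joined.map_commute {M : Type*} [Group M] (f : GraphProduct Γ G →* M) {S T : Set V}
    (h : Joined Γ S T) : ∀ a ∈ (vertexSubgroup Γ G S).map f,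
      ∀ c ∈ (vertexSubgroup Γ G T).map f, Commute a c := by
  rintro _ ⟨a, ha, rfl⟩ _ ⟨c, hc, rfl⟩
  exact (h.commute ha hc).map f

theorem map_inf_map_eq_bot {M : Type*} [Group M] {f : GraphProduct Γ G →* M} {N S T : Set V}
    (hf : Set.InjOn f (vertexSubgroup Γ G N)) (hS : S ⊆ N) (hT : T ⊆ N) (h : Disjoint S T) :
    (vertexSubgroup Γ G S).map f ⊓ (vertexSubgroup Γ G T).map f = ⊥ := by
  rw [eq_bot_iff]
  rintro _ ⟨⟨a, ha, rfl⟩, c, hc, hac⟩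
  have h1 := hf (vertexSubgroup_mono hT hc) (vertexSubgroup_mono hS ha) hac
  have h2 : a ∈ vertexSubgroup Γ G S ⊓ vertexSubgroup Γ G T := ⟨ha, h1 ▸ hc⟩
  rw [vertexSubgroup_inf, h.inter_eq, vertexSubgroup_empty, Subgroup.mem_bot] at h2
  rw [h2, map_one]
  exact one_mem _

theorem map_ne_bot [∀ v, Nontrivial (G v)] {M : Type*} [Group M] {f : GraphProduct Γ G →* M}
    {N S : Set V} (hf : Set.InjOn f (vertexSubgroup Γ G N)) (hS : S ⊆ N) (hne : S.Nonempty) :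
    (vertexSubgroup Γ G S).map f ≠ ⊥ := by
  obtain ⟨v, hv⟩ := hne
  obtain ⟨g, hg⟩ := exists_ne (1 : G v)
  intro h
  have h1 : f (of Γ G v g) = 1 := by
    rw [← Subgroup.mem_bot, ← h]
    exact ⟨_, of_mem hv g, rfl⟩
  have h2 := hf (of_mem (hS hv) g) (one_mem _) (h1.trans (map_one f).symm)
  exact hg (of_injective v (h2.trans (map_one _).symm))

/-- The vertex-group of a cone vertex of `N` is a direct factor of `⟨N⟩`. -/
theorem map_singleton_le [Finite W] [∀ w, Nontrivial (H w)]
    (hG : ∀ v, GraphicallyIrreducible (G v)) {f : GraphProduct Γ G →* GraphProduct Δ H} {N : Set V}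
    (hf : Set.InjOn f (vertexSubgroup Γ G N)) {t : V} (ht : t ∈ N) (htN : N ⊆ Γ.vertexStar t)
    {K U : Set W} (hKU : Joined Δ K U) (hU : ConeFree Δ U)
    (hmap : (vertexSubgroup Γ G N).map f = vertexSubgroup Δ H (K ∪ U)) :
    (vertexSubgroup Γ G {t}).map f ≤ vertexSubgroup Δ H K := by
  obtain ⟨e⟩ := nonempty_equiv_map hf ht
  have hj : Joined Γ {t} (N \ {t}) := by
    rintro _ rfl x hx
    exact (htN hx.1).resolve_left hx.2
  refine (hG t).le_vertexSubgroup e (hj.map_commute f) ?_ hKU hU ?_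
  · exact map_inf_map_eq_bot hf (Set.singleton_subset_iff.2 ht) Set.sdiff_subset hj.disjoint
  · rw [map_vertexSubgroup_union, Set.union_sdiff_cancel (Set.singleton_subset_iff.2 ht), hmap]

theorem _root_.GraphicallyIrreducible.adj_of_equiv [Finite V] [∀ v, Nontrivial (G v)]
    {A' : Type*} [Group A'] (hA' : GraphicallyIrreducible A') {I : Set V}
    (e : A' ≃* vertexSubgroup Γ G I) {i j : V} (hi : i ∈ I) (hj : j ∈ I) (hij : i ≠ j) :
    Γ.Adj i j := by
  refine hA'.adj_of_retract e (vertexSubgroup Γ G I).subtype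
    ((retract Γ G I).codRestrict (vertexSubgroup Γ G I) (retract_mem I)) (fun a => a.2)
    (fun x hx => retract_eq_self hx) (fun a ha x _ => ?_) hi hj hij
  rw [show a = 1 from Subtype.ext ha]
  exact Commute.one_left _

theorem map_symm_eq {φ : GraphProduct Γ G ≃* GraphProduct Δ H} {A : Subgroup (GraphProduct Γ G)}
    {B : Subgroup (GraphProduct Δ H)} (h : A.map φ.toMonoidHom = B) :
    B.map φ.symm.toMonoidHom = A := by
  rw [← h, Subgroup.map_map]
  convert Subgroup.map_id A
  ext x
  simp

theorem map_trans_conj (φ : GraphProduct Γ G ≃* GraphProduct Δ H) (g : GraphProduct Δ H)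
    (A : Subgroup (GraphProduct Γ G)) :
    A.map (φ.trans (MulAut.conj g)).toMonoidHom = conjSubgroup g (A.map φ.toMonoidHom) := by
  rw [conjSubgroup, Subgroup.map_map]
  rfl

theorem _root_.conjSubgroup_conjSubgroup {M : Type*} [Group M] (g h : M) (A : Subgroup M) :
    conjSubgroup g (conjSubgroup h A) = conjSubgroup (g * h) A := by
  ext x
  simp only [mem_conjSubgroup, mul_inv_rev, mul_assoc]

theorem _root_.conjSubgroup_one {M : Type*} [Group M] (A : Subgroup M) :
    conjSubgroup 1 A = A := by
  ext x
  simp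

theorem _root_.conjSubgroup_eq_self {M : Type*} [Group M] {A : Subgroup M} {g : M} (hg : g ∈ A) :
    conjSubgroup g A = A := by
  ext x
  rw [mem_conjSubgroup, mul_mem_cancel_right hg, mul_mem_cancel_left (inv_mem hg)]

theorem injOn_equiv {M : Type*} [Group M] (φ : GraphProduct Γ G ≃* M)
    (S : Set (GraphProduct Γ G)) : Set.InjOn φ.toMonoidHom S :=
  φ.injective.injOn

/-- A cone vertex of `N` would give a non-trivial graphically irreducible direct factor of `⟨N'⟩`,
and there is none. -/
theorem coneFree_of_map [Finite V] [Finite W] [∀ v, Nontrivial (G v)] [∀ w, Nontrivial (H w)]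
    (hG : ∀ v, GraphicallyIrreducible (G v)) {f : GraphProduct Γ G →* GraphProduct Δ H} {N : Set V}
    (hf : Set.InjOn f (vertexSubgroup Γ G N)) {N' : Set W} (hN' : ConeFree Δ N')
    (hmap : (vertexSubgroup Γ G N).map f = vertexSubgroup Δ H N') : ConeFree Γ N := by
  intro t ht htN
  have h := map_singleton_le hG hf ht htN (K := ∅) (U := N') (fun _ h => h.elim) hN' (by
    rw [hmap, Set.empty_union])
  rw [vertexSubgroup_empty, le_bot_iff] at h
  exact map_ne_bot hf (Set.singleton_subset_iff.2 ht) (Set.singleton_nonempty t) h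

/-- An isomorphism between `⟨N⟩` and `⟨N'⟩` which sends a maximal join of `N` into a join of `N'` sends
it onto this join. -/
theorem map_eq_of_isJoin [Finite V] [∀ v, Nontrivial (G v)] [∀ w, Nontrivial (H w)]
    {φ : GraphProduct Γ G ≃* GraphProduct Δ H} {N M : Set V} {N' S : Set W}
    (hmap : (vertexSubgroup Γ G N).map φ.toMonoidHom = vertexSubgroup Δ H N')
    (hM : IsJoin Γ M) (hmax : ∀ R, R ⊆ N → IsJoin Γ R → M ⊆ R → R = M)
    (hSN : S ⊆ N') (hS : IsJoin Δ S)
    (hle : (vertexSubgroup Γ G M).map φ.toMonoidHom ≤ vertexSubgroup Δ H S) :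
    (vertexSubgroup Γ G M).map φ.toMonoidHom = vertexSubgroup Δ H S := by
  refine le_antisymm hle ?_
  obtain ⟨P, P', hP, hP', hj, rfl⟩ := hS
  have hinj := injOn_equiv φ.symm (vertexSubgroup Δ H (P ∪ P'))
  have hmap' := map_symm_eq hmap
  obtain ⟨R, hRN, n, -, hR, hn⟩ := exists_not_isIrred (N := N)
    (hmap' ▸ Subgroup.map_mono (vertexSubgroup_mono (Set.subset_union_left.trans hSN)))
    (hmap' ▸ Subgroup.map_mono (vertexSubgroup_mono (Set.subset_union_right.trans hSN)))
    (hj.map_commute φ.symm.toMonoidHom)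
    (map_inf_map_eq_bot hinj Set.subset_union_left Set.subset_union_right hj.disjoint)
    (map_ne_bot hinj Set.subset_union_left hP) (map_ne_bot hinj Set.subset_union_right hP')
  rw [map_vertexSubgroup_union] at hn
  have hMR : vertexSubgroup Γ G M ≤ conjSubgroup n (vertexSubgroup Γ G R) := by
    rw [← map_symm_eq (φ := φ) (A := vertexSubgroup Γ G M) rfl]
    exact (Subgroup.map_mono hle).trans hn
  have hMR' : M ⊆ R := subset_of_conj_mem fun x hx => mem_conjSubgroup.1 (hMR hx)
  obtain rfl : R = M := by
    refine hmax R hRN ((subsingleton_or_isJoin hR).resolve_left fun h => ?_) hMR'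
    obtain ⟨Q, Q', ⟨q, hq⟩, ⟨q', hq'⟩, hj', rfl⟩ := hM
    exact (hj' q hq q' hq').ne (h (hMR' (Or.inl hq)) (hMR' (Or.inr hq')))
  rw [conjSubgroup_eq_of_le hMR] at hn
  have h : ((vertexSubgroup Δ H (P ∪ P')).map φ.symm.toMonoidHom).map φ.toMonoidHom =
    vertexSubgroup Δ H (P ∪ P') := map_symm_eq (φ := φ.symm) rfl
  rw [← h]
  exact Subgroup.map_mono hn

/-- If an isomorphism between `⟨N⟩` and `⟨N'⟩` sends some vertex-groups into the vertex-group of an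
isolated vertex of `N'`, the corresponding vertices form a clique, which is a union of connected
components of `N`. -/
theorem adj_of_map_le_isolated [Finite V] [Finite W] [∀ v, Nontrivial (G v)]
    [∀ w, Nontrivial (H w)] (hH : ∀ w, GraphicallyIrreducible (H w))
    {φ : GraphProduct Γ G ≃* GraphProduct Δ H} {N : Set V} {N' : Set W}
    (hmap : (vertexSubgroup Γ G N).map φ.toMonoidHom = vertexSubgroup Δ H N') {t : W} (ht : t ∈ N')
    (hiso : ∀ t' ∈ N', ¬ Δ.Adj t t') {p q : V} (hp : p ∈ N) (hq : q ∈ N) (hpq : p ≠ q)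
    (hpt : (vertexSubgroup Γ G {p}).map φ.toMonoidHom ≤ vertexSubgroup Δ H {t})
    (hqt : (vertexSubgroup Γ G {q}).map φ.toMonoidHom ≤ vertexSubgroup Δ H {t}) : Γ.Adj p q := by
  let N₀ : Set V :=
    {q | q ∈ N ∧ (vertexSubgroup Γ G {q}).map φ.toMonoidHom ≤ vertexSubgroup Δ H {t}}
  have hN₀ : N₀ ⊆ N := fun q hq => hq.1
  have hstar : Δ.vertexStar t ∩ N' = {t} := by
    ext x
    refine ⟨fun hx => hx.1.resolve_right (hiso x hx.2), ?_⟩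
    rintro rfl
    exact ⟨Or.inl rfl, ht⟩
  have hprop : ∀ p ∈ N₀, ∀ q ∈ N \ N₀, ¬ Γ.Adj p q := by
    intro p hp q hq hpq
    refine hq.2 ⟨hq.1, ?_⟩
    obtain ⟨g, hg⟩ := exists_ne (1 : G p)
    obtain ⟨k, hk⟩ := mem_vertexSubgroup_singleton.1 (hp.2 ⟨_, of_mem (Set.mem_singleton p) g, rfl⟩)
    have hk1 : k ≠ 1 := by
      rintro rfl
      rw [map_one] at hk
      exact hg (of_injective p ((φ.map_eq_one_iff.1 hk.symm).trans (map_one _).symm))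
    rintro _ ⟨x, hx, rfl⟩
    rw [← hstar, ← vertexSubgroup_inf]
    refine ⟨mem_star_of_commute hk1 ?_, hmap ▸ ⟨x, ?_, rfl⟩⟩
    · rw [hk]
      obtain ⟨l, rfl⟩ := mem_vertexSubgroup_singleton.1 hx
      exact (of_commute hpq.symm l g).map φ.toMonoidHom
    · exact vertexSubgroup_mono (Set.singleton_subset_iff.2 hq.1) hx
  obtain ⟨e⟩ := nonempty_equiv_map (injOn_equiv φ.symm (vertexSubgroup Δ H {t}))
    (Set.mem_singleton t)
  have hle : vertexSubgroup Γ G N₀ ≤ (vertexSubgroup Δ H {t}).map φ.symm.toMonoidHom := by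
    refine vertexSubgroup_le.2 fun v hv g => ⟨φ (of Γ G v g), ?_, by simp⟩
    exact hv.2 ⟨_, of_mem (Set.mem_singleton v) g, rfl⟩
  have heq := (hH t).eq_vertexSubgroup e (N₁ := N \ N₀) Set.disjoint_sdiff_right hprop hle (by
    rw [Set.union_sdiff_cancel hN₀, ← map_symm_eq hmap]
    exact Subgroup.map_mono (vertexSubgroup_mono (Set.singleton_subset_iff.2 ht))) (by
    rw [Ne, vertexSubgroup_eq_bot_iff]
    exact Set.Nonempty.ne_empty ⟨p, hp, hpt⟩)
  exact (hH t).adj_of_equiv (e.trans (MulEquiv.subgroupCongr heq)) (I := N₀) ⟨hp, hpt⟩ ⟨hq, hqt⟩ hpq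

end GraphProduct

namespace GraphProduct

variable {V : Type*} {Γ : SimpleGraph V} {G : V → Type*} [∀ v, Group (G v)]
variable {W : Type*} {Δ : SimpleGraph W} {H : W → Type*} [∀ w, Group (H w)]

/-! ### Images of the classes of maximal vertices are parabolic -/

/-- `N` contains the class of `u`, and each neighbour of `u` belongs to `N` or is adjacent to all
the vertices of `N`. -/
def Surrounds (Γ : SimpleGraph V) (u : V) (N : Set V) : Prop :=
  Γ.precClass u ⊆ N ∧ Γ.neighborSet u ⊆ N ∪ commonLink Γ N

variable {u : V} {N : Set V}

theorem Surrounds.mem (hN : Surrounds Γ u N) : u ∈ N := hN.1 (SimpleGraph.mem_precClass u)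

/-- A subset of `N` which contains the neighbours of `u` in `N` and the class of `u` surrounds `u`
when `N` does. -/
theorem Surrounds.of_subset (hN : Surrounds Γ u N) {M : Set V} (hM : M ⊆ N)
    (huM : Γ.precClass u ⊆ M) (h : ∀ x ∈ N, Γ.Adj u x → x ∈ M ∪ commonLink Γ M) :
    Surrounds Γ u M :=
  ⟨huM, fun x hx => (hN.2 hx).elim (fun h' => h x h' hx) fun h' => Or.inr (commonLink_anti hM h')⟩

theorem Surrounds.not_subset_star (hadj : ∀ p, Γ.Adj u p → ¬ Γ.Prec u p)
    (hN : Surrounds Γ u N) {p : V} (hp : p ∈ N) (hup : Γ.Adj u p) :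
    ¬ ∀ x ∈ N, Γ.Adj u x → x ∈ Γ.vertexStar p := fun h =>
  hadj p hup fun x hx => (hN.2 hx).elim (fun h' => h x h' hx) fun h' => Or.inr (h' p hp)

variable [Finite W] [∀ w, Nontrivial (H w)]
  {φ : GraphProduct Γ G ≃* GraphProduct Δ H} {N' : Set W}

/-- If `N` is a join and no vertex of `N'` is adjacent to all the others, the factor of the join which
contains `u` is sent to a factor of `⟨N'⟩`. -/
theorem exists_map_eq_of_isJoin (hadj : ∀ p, Γ.Adj u p → ¬ Γ.Prec u p) (hN : Surrounds Γ u N)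
    (hmap : (vertexSubgroup Γ G N).map φ.toMonoidHom = vertexSubgroup Δ H N')
    (hN' : ConeFree Δ N') (hjoin : IsJoin Γ N) :
    ∃ M, M ⊂ N ∧ Surrounds Γ u M ∧
      ∃ M' : Set W, (vertexSubgroup Γ G M).map φ.toMonoidHom = vertexSubgroup Δ H M' := by
  obtain ⟨R, R', hR', hj, rfl, huR⟩ :
      ∃ R R' : Set V, R'.Nonempty ∧ Joined Γ R R' ∧ N = R ∪ R' ∧ u ∈ R := by
    obtain ⟨R, R', hR, hR', hj, rfl⟩ := hjoin
    rcases hN.mem with h | h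
    · exact ⟨R, R', hR', hj, rfl, h⟩
    · exact ⟨R', R, hR, hj.symm, Set.union_comm _ _, h⟩
  obtain ⟨I, -, hI, -⟩ := hN'.exists_eq_vertexSubgroup (hj.map_commute φ.toMonoidHom)
    ((map_vertexSubgroup_union _ _ _).trans hmap)
  refine ⟨R, Set.subset_union_left.ssubset_of_ne fun h => ?_,
    hN.of_subset Set.subset_union_left (fun v hv => ?_) fun x hx _ => ?_, I, hI⟩
  · obtain ⟨x, hx⟩ := hR'
    exact Set.disjoint_left.1 hj.disjoint (h ▸ Or.inr hx) hx
  · exact (hN.1 hv).resolve_right fun h =>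
      SimpleGraph.not_adj_of_mem_precClass hadj hv (hj u huR v h)
  · exact hx.imp_right fun h => hj.subset_commonLink h

variable [Finite V] [∀ v, Nontrivial (G v)]

/-- If `u` is a cone vertex of `N`, it is the only one, so that its vertex-group corresponds to the
product of the vertex-groups of the cone vertices of `N'`. -/
theorem exists_map_singleton_eq (hG : ∀ v, GraphicallyIrreducible (G v)) 
    (hH : ∀ w, GraphicallyIrreducible (H w))
    (hadj : ∀ p, Γ.Adj u p → ¬ Γ.Prec u p) (hN : Surrounds Γ u N)
    (hmap : (vertexSubgroup Γ G N).map φ.toMonoidHom = vertexSubgroup Δ H N')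
    (hcone : N ⊆ Γ.vertexStar u) :
    ∃ K : Set W, (vertexSubgroup Γ G {u}).map φ.toMonoidHom = vertexSubgroup Δ H K := by
  let K : Set W := {t | t ∈ N' ∧ N' ⊆ Δ.vertexStar t}
  have hKN : K ⊆ N' := fun t ht => ht.1
  have hK : Joined Δ K (N' \ K) := fun k hk x hx =>
    (hk.2 hx.1).resolve_left fun h => hx.2 (h ▸ hk)
  have hK' : ConeFree Δ (N' \ K) := by
    refine fun v hv h => hv.2 ⟨hv.1, fun x hx => ?_⟩
    by_cases hxK : x ∈ K
    · exact Or.inr (hK x hxK v hv).symm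
    · exact h ⟨hx, hxK⟩
  have hu : Joined Γ {u} (N \ {u}) := by
    rintro _ rfl x hx
    exact (hcone hx.1).resolve_left hx.2
  have hu' : ConeFree Γ (N \ {u}) := fun p hp h =>
    hN.not_subset_star hadj hp.1 (hu u rfl p hp) fun x hx hux => h ⟨hx, hux.ne'⟩
  have huN : {u} ∪ N \ {u} = N := Set.union_sdiff_cancel (Set.singleton_subset_iff.2 hN.mem)
  refine ⟨K, le_antisymm ?_ (vertexSubgroup_le.2 fun t ht g => ?_)⟩
  · exact map_singleton_le hG (injOn_equiv φ _) hN.mem hcone hK hK' (by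
      rw [hmap, Set.union_sdiff_cancel hKN])
  · have h := map_singleton_le hH (injOn_equiv φ.symm _) ht.1 ht.2 hu hu' (by
      rw [map_symm_eq hmap, huN])
    exact ⟨φ.symm (of Δ H t g), h ⟨_, of_mem (Set.mem_singleton t) g, rfl⟩, by simp⟩

/-- When `N` and `N'` are irreducible, a maximal join of `N` which contains the class of `u` and a
neighbour of `u` is sent to a conjugate of a join of `N'`. It cannot be sent into the vertex-group
of an isolated vertex, since otherwise this join would be a clique. -/
theorem exists_map_eq_of_isIrred (hH : ∀ w, GraphicallyIrreducible (H w))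
    (hadj : ∀ p, Γ.Adj u p → ¬ Γ.Prec u p) (hN : Surrounds Γ u N)
    (hmap : (vertexSubgroup Γ G N).map φ.toMonoidHom = vertexSubgroup Δ H N')
    (hirr : IsIrred Γ N) {p : V} (hp : p ∈ N) (hup : Γ.Adj u p) :
    ∃ M, M ⊂ N ∧ Surrounds Γ u M ∧ ∃ (M' : Set W) (s : GraphProduct Δ H),
      (vertexSubgroup Γ G M).map φ.toMonoidHom = conjSubgroup s (vertexSubgroup Δ H M') := by
  have hJ : Γ.precClass u ∪ Γ.neighborSet u ∩ N ⊆ N :=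
    Set.union_subset hN.1 Set.inter_subset_right
  obtain ⟨M, hJM, ⟨hMN, hM⟩, hmax⟩ :=
    (Set.toFinite {M : Set V | M ⊆ N ∧ IsJoin Γ M}).exists_le_maximal
      (show Γ.precClass u ∪ Γ.neighborSet u ∩ N ∈ {M : Set V | M ⊆ N ∧ IsJoin Γ M} from
        ⟨hJ, Γ.precClass u, Γ.neighborSet u ∩ N, ⟨u, SimpleGraph.mem_precClass u⟩,
        ⟨p, hup, hp⟩, (SimpleGraph.joined_precClass hadj).mono subset_rfl Set.inter_subset_left,
        rfl⟩)
  have hmax' : ∀ R, R ⊆ N → IsJoin Γ R → M ⊆ R → R = M := fun R h1 h2 h3 =>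
    Set.Subset.antisymm (hmax ⟨h1, h2⟩ h3) h3
  refine ⟨M, hMN.ssubset_of_ne fun h => hirr.not_isJoin (h ▸ hM), hN.of_subset hMN
    (Set.subset_union_left.trans hJM) fun x hx hux => Or.inl (hJM (Or.inr ⟨hux, hx⟩)), ?_⟩
  have hM0 := hM
  obtain ⟨R, R', hR, hR', hj, rfl⟩ := hM
  have hinj := injOn_equiv φ (vertexSubgroup Γ G (R ∪ R'))
  obtain ⟨S, hSN, s, hs, hS, hle⟩ := exists_not_isIrred (N := N')
    (hmap ▸ Subgroup.map_mono (vertexSubgroup_mono (Set.subset_union_left.trans hMN)))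
    (hmap ▸ Subgroup.map_mono (vertexSubgroup_mono (Set.subset_union_right.trans hMN)))
    (hj.map_commute φ.toMonoidHom)
    (map_inf_map_eq_bot hinj Set.subset_union_left Set.subset_union_right hj.disjoint)
    (map_ne_bot hinj Set.subset_union_left hR) (map_ne_bot hinj Set.subset_union_right hR')
  rw [map_vertexSubgroup_union] at hle
  generalize R ∪ R' = M at *
  -- Up to an inner automorphism, `s = 1`.
  obtain ⟨ψ, hψ⟩ : ∃ ψ : GraphProduct Γ G ≃* GraphProduct Δ H, ∀ A : Subgroup (GraphProduct Γ G),
      A.map ψ.toMonoidHom = conjSubgroup s⁻¹ (A.map φ.toMonoidHom) := ⟨_, map_trans_conj φ s⁻¹⟩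
  have hψ' : ∀ A : Subgroup (GraphProduct Γ G),
      A.map φ.toMonoidHom = conjSubgroup s (A.map ψ.toMonoidHom) := fun A => by
    rw [hψ, conjSubgroup_conjSubgroup, mul_inv_cancel, conjSubgroup_one]
  have hmapψ : (vertexSubgroup Γ G N).map ψ.toMonoidHom = vertexSubgroup Δ H N' := by
    rw [hψ, hmap, conjSubgroup_eq_self (inv_mem hs)]
  have hleψ : (vertexSubgroup Γ G M).map ψ.toMonoidHom ≤ vertexSubgroup Δ H S := by
    have h : conjSubgroup s⁻¹ ((vertexSubgroup Γ G M).map φ.toMonoidHom) ≤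
      conjSubgroup s⁻¹ (conjSubgroup s (vertexSubgroup Δ H S)) := Subgroup.map_mono hle
    rwa [← hψ, conjSubgroup_conjSubgroup, inv_mul_cancel, conjSubgroup_one] at h
  suffices h : ∃ S' : Set W, (vertexSubgroup Γ G M).map ψ.toMonoidHom = vertexSubgroup Δ H S' by
    obtain ⟨S', h⟩ := h
    exact ⟨S', s, by rw [hψ', h]⟩
  have hjoin : ∀ S' ⊆ N', IsJoin Δ S' → S ⊆ S' →
      (vertexSubgroup Γ G M).map ψ.toMonoidHom = vertexSubgroup Δ H S' := fun S' h1 h2 h3 =>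
    map_eq_of_isJoin hmapψ hM0 hmax' h1 h2 (hleψ.trans (vertexSubgroup_mono h3))
  rcases subsingleton_or_isJoin hS with h | h
  swap
  · exact ⟨S, hjoin S hSN h subset_rfl⟩
  rcases h.eq_empty_or_singleton with rfl | ⟨t, rfl⟩
  · rw [vertexSubgroup_empty, le_bot_iff] at hleψ
    exact ⟨∅, by rw [hleψ, vertexSubgroup_empty]⟩
  have htN : t ∈ N' := hSN rfl
  by_cases hiso : ∃ t' ∈ N', Δ.Adj t t'
  · obtain ⟨t', ht', htt'⟩ := hiso
    refine ⟨{t} ∪ {t'}, hjoin _ (Set.union_subset hSN (Set.singleton_subset_iff.2 ht'))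
      ⟨{t}, {t'}, Set.singleton_nonempty t, Set.singleton_nonempty t', ?_, rfl⟩
      Set.subset_union_left⟩
    rintro _ rfl _ rfl
    exact htt'
  · push Not at hiso
    have hmem : ∀ x ∈ M, (vertexSubgroup Γ G {x}).map ψ.toMonoidHom ≤ vertexSubgroup Δ H {t} :=
      fun x hx => (Subgroup.map_mono (vertexSubgroup_mono (Set.singleton_subset_iff.2 hx))).trans
        hleψ
    refine absurd (fun x hx hux => ?_) (hN.not_subset_star hadj hp hup)
    by_cases hxp : x = p
    · exact Or.inl hxp
    · exact Or.inr (adj_of_map_le_isolated hH hmapψ htN hiso hp hx (Ne.symm hxp)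
        (hmem p (hJM (Or.inr ⟨hup, hp⟩))) (hmem x (hJM (Or.inr ⟨hux, hx⟩))))

/-- If `⟨N⟩` is sent to a parabolic subgroup and `N` is larger than the class of `u`, then a smaller
set which surrounds `u` has the same property. -/
theorem exists_ssubset_map_eq (hG : ∀ v, GraphicallyIrreducible (G v)) 
    (hH : ∀ w, GraphicallyIrreducible (H w))
    (hu : Γ.IsPrecMaximal u) (hadj : ∀ p, Γ.Adj u p → ¬ Γ.Prec u p)
    (hN : Surrounds Γ u N) (hne : N ≠ Γ.precClass u)
    (hmap : (vertexSubgroup Γ G N).map φ.toMonoidHom = vertexSubgroup Δ H N') :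
    ∃ M, M ⊂ N ∧ Surrounds Γ u M ∧ ∃ (M' : Set W) (s : GraphProduct Δ H),
      (vertexSubgroup Γ G M).map φ.toMonoidHom = conjSubgroup s (vertexSubgroup Δ H M') := by
  by_cases hcone : N ⊆ Γ.vertexStar u
  · have hclass : Γ.precClass u = {u} := by
      ext v
      refine ⟨fun hv => (hcone (hN.1 hv)).resolve_right
        (SimpleGraph.not_adj_of_mem_precClass hadj hv), ?_⟩
      rintro rfl
      exact SimpleGraph.mem_precClass v
    obtain ⟨K, hK⟩ := exists_map_singleton_eq hG hH hadj hN hmap hcone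
    refine ⟨{u}, (hclass ▸ hN.1).ssubset_of_ne fun h => hne (h.symm.trans hclass.symm),
      ⟨hclass.subset, fun x hx => Or.inr ?_⟩, K, 1, by rw [hK, conjSubgroup_one]⟩
    rintro _ rfl
    exact hx
  have hNcone : ConeFree Γ N := by
    intro p hp h
    rcases h hN.mem with rfl | hup
    · exact hcone h
    · exact hN.not_subset_star hadj hp (Γ.adj_symm hup) fun x hx _ => h hx
  have hNcone' : ConeFree Δ N' :=
    coneFree_of_map hH (injOn_equiv φ.symm _) hNcone (map_symm_eq hmap)
  by_cases hjoin : IsJoin Γ N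
  · obtain ⟨M, hM, hMs, M', h⟩ := exists_map_eq_of_isJoin hadj hN hmap hNcone' hjoin
    exact ⟨M, hM, hMs, M', 1, by rw [h, conjSubgroup_one]⟩
  have hirr : IsIrred Γ N := by
    by_contra h
    refine hcone fun x hx => Or.inl ?_
    exact (subsingleton_or_isJoin h).resolve_right hjoin hx hN.mem
  obtain ⟨p, hp, hup⟩ : ∃ p ∈ N, Γ.Adj u p := by
    by_contra! h
    refine hne (Set.Subset.antisymm (fun v hv => ?_) hN.1)
    have hv' : Γ.Prec u v := fun x hx =>
      (hN.2 hx).elim (fun h' => absurd hx (h x h')) fun h' => Or.inr (h' v hv)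
    exact ⟨hv', hu v hv'⟩
  exact exists_map_eq_of_isIrred hH hadj hN hmap hirr hp hup

theorem exists_map_precClass_eq (hG : ∀ v, GraphicallyIrreducible (G v)) 
    (hH : ∀ w, GraphicallyIrreducible (H w))
    (φ : GraphProduct Γ G ≃* GraphProduct Δ H)
    (hu : Γ.IsPrecMaximal u) (hadj : ∀ p, Γ.Adj u p → ¬ Γ.Prec u p) :
    ∃ (M' : Set W) (s : GraphProduct Δ H), (vertexSubgroup Γ G (Γ.precClass u)).map φ.toMonoidHom =
      conjSubgroup s (vertexSubgroup Δ H M') := by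
  obtain ⟨N, ⟨hN, N', s, hmap⟩, hmin⟩ := (Set.toFinite {N : Set V | Surrounds Γ u N ∧
      ∃ (M' : Set W) (s : GraphProduct Δ H), (vertexSubgroup Γ G N).map φ.toMonoidHom =
        conjSubgroup s (vertexSubgroup Δ H M')}).exists_minimal
    ⟨Set.univ, ⟨Set.subset_univ _, fun x _ => Or.inl (Set.mem_univ x)⟩, Set.univ, 1, by
      rw [conjSubgroup_one, vertexSubgroup_univ, vertexSubgroup_univ]
      exact Subgroup.map_top_of_surjective _ φ.surjective⟩
  by_cases hne : N = Γ.precClass u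
  · exact ⟨N', s, hne ▸ hmap⟩
  exfalso
  obtain ⟨M, hM, hMs, M', g, hMmap⟩ := exists_ssubset_map_eq hG hH
    (φ := φ.trans (MulAut.conj s⁻¹)) hu hadj hN hne (N' := N') (by
      rw [map_trans_conj, hmap, conjSubgroup_conjSubgroup, inv_mul_cancel, conjSubgroup_one])
  refine hM.not_subset (hmin ⟨hMs, M', s * g, ?_⟩ hM.subset)
  rw [← conjSubgroup_conjSubgroup, ← hMmap, map_trans_conj, conjSubgroup_conjSubgroup,
    mul_inv_cancel, conjSubgroup_one]

end GraphProduct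

namespace GraphProduct

variable {V : Type*} {Γ : SimpleGraph V} {G : V → Type*} [∀ v, Group (G v)]
variable {W : Type*} {Δ : SimpleGraph W} {H : W → Type*} [∀ w, Group (H w)]

/-! ### Comparison of the classes of maximal vertices -/

theorem map_union_commonLink_le [Finite W] [∀ w, Nontrivial (H w)]
    {φ : GraphProduct Γ G ≃* GraphProduct Δ H} {S : Set V} {S' : Set W}
    (hmap : (vertexSubgroup Γ G S).map φ.toMonoidHom = vertexSubgroup Δ H S') :
    (vertexSubgroup Γ G (S ∪ commonLink Γ S)).map φ.toMonoidHom ≤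
      vertexSubgroup Δ H (S' ∪ commonLink Δ S') := by
  rw [← map_vertexSubgroup_union, hmap]
  refine sup_le (vertexSubgroup_mono Set.subset_union_left) ?_
  rw [Subgroup.map_le_iff_le_comap]
  refine vertexSubgroup_le.2 fun v hv g => mem_union_of_commute fun y hy => ?_
  rw [← hmap] at hy
  obtain ⟨x, hx, rfl⟩ := hy
  exact ((joined_commonLink S).commute hx (of_mem hv g)).symm.map φ.toMonoidHom

/-- An isomorphism which sends `⟨S⟩` to a parabolic subgroup also sends the subgroup generated by
`⟨S⟩` and its centraliser to a parabolic subgroup. -/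
theorem map_union_commonLink [Finite V] [Finite W] [∀ v, Nontrivial (G v)]
    [∀ w, Nontrivial (H w)] {φ : GraphProduct Γ G ≃* GraphProduct Δ H} {S : Set V} {S' : Set W}
    (hmap : (vertexSubgroup Γ G S).map φ.toMonoidHom = vertexSubgroup Δ H S') :
    (vertexSubgroup Γ G (S ∪ commonLink Γ S)).map φ.toMonoidHom =
      vertexSubgroup Δ H (S' ∪ commonLink Δ S') := by
  refine le_antisymm (map_union_commonLink_le hmap) ?_
  have h : ((vertexSubgroup Δ H (S' ∪ commonLink Δ S')).map φ.symm.toMonoidHom).map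
    φ.toMonoidHom = vertexSubgroup Δ H (S' ∪ commonLink Δ S') := map_symm_eq (φ := φ.symm) rfl
  rw [← h]
  exact Subgroup.map_mono (map_union_commonLink_le (map_symm_eq hmap))

variable [Finite V] [∀ v, Nontrivial (G v)]

/-- Let `B` be a subgroup of `⟨[u]⟩ × ⟨link u⟩` which projects onto `⟨link u⟩`. The centraliser of
`B` is contained in `⟨[u]⟩`. -/
theorem mem_precClass_of_commute {u : V} (hu : Γ.IsPrecMaximal u)
    (hadj : ∀ p, Γ.Adj u p → ¬ Γ.Prec u p) {B : Subgroup (GraphProduct Γ G)}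
    (hB : B ≤ vertexSubgroup Γ G (Γ.precClass u ∪ Γ.neighborSet u))
    (hproj : B.map (retract Γ G (Γ.neighborSet u)) = vertexSubgroup Γ G (Γ.neighborSet u))
    {y : GraphProduct Γ G} (hy : ∀ b ∈ B, Commute y b) :
    y ∈ vertexSubgroup Γ G (Γ.precClass u) := by
  obtain ⟨R, hR, s, hs, hfull⟩ := exists_isFull hB
  have hLR : Γ.neighborSet u ⊆ R := by
    have h : vertexSubgroup Γ G (Γ.neighborSet u) ≤ vertexSubgroup Γ G (Γ.neighborSet u ∩ R) := by
      have h1 := retract_mem (Γ := Γ) (G := G) (Γ.neighborSet u) s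
      rw [← conjSubgroup_eq_self (inv_mem h1), ← hproj, ← map_retract]
      rintro _ ⟨_, ⟨b, hb, rfl⟩, rfl⟩
      exact ⟨_, hfull.1 ⟨b, hb, rfl⟩, by simp⟩
    exact (vertexSubgroup_le_iff.1 h).trans Set.inter_subset_right
  have h1 : s⁻¹ * y * s ∈ vertexSubgroup Γ G (R ∪ commonLink Γ R) := by
    refine hfull.mem_of_conj fun a ha => ?_
    rw [mem_conjSubgroup, inv_inv] at ha
    have h2 : (s⁻¹ * y * s)⁻¹ * a * (s⁻¹ * y * s) = s⁻¹ * (y⁻¹ * ((s * a * s⁻¹) * y)) * s := by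
      group
    rw [h2, ← (hy _ ha).eq, inv_mul_cancel_left]
    refine hfull.1 (mem_conjSubgroup.2 ?_)
    convert ha using 1
    group
  have h2 : y ∈ vertexSubgroup Γ G (Γ.precClass u ∪ Γ.neighborSet u) := by
    have h3 := vertexSubgroup_mono (Set.union_subset hR
      ((hu.commonLink_subset hLR).trans Set.subset_union_left)) h1
    rwa [mul_mem_cancel_right hs, mul_mem_cancel_left (inv_mem hs)] at h3
  have h3 : retract Γ G (Γ.neighborSet u) y = 1 := by
    refine (SimpleGraph.coneFree_neighborSet hadj).eq_one_of_commute (retract_mem _ _)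
      fun z hz => ?_
    rw [← hproj] at hz
    obtain ⟨b, hb, rfl⟩ := hz
    exact (hy b hb).map _
  rw [← (SimpleGraph.joined_precClass hadj).retract_mul_retract h2, h3, mul_one]
  exact retract_mem _ _

variable [Finite W] [∀ w, Nontrivial (H w)]

/-- If `⟨[u]⟩` is sent to `⟨N'⟩`, then `⟨N'⟩` commutes with `⟨T⟩` for the set `T` of the vertices
adjacent to all of `N'`, and a maximal vertex above a vertex of `N'` is also adjacent to all of `T`.
The centraliser of `⟨T⟩` is itself contained in the image of `⟨[u]⟩`. -/
theorem exists_precClass_le_map (hH : ∀ w, GraphicallyIrreducible (H w))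
    {φ : GraphProduct Γ G ≃* GraphProduct Δ H} {u : V} (hu : Γ.IsPrecMaximal u)
    (hadj : ∀ p, Γ.Adj u p → ¬ Γ.Prec u p) {N' : Set W}
    (hmap : (vertexSubgroup Γ G (Γ.precClass u)).map φ.toMonoidHom = vertexSubgroup Δ H N') :
    ∃ v, Δ.IsPrecMaximal v ∧ vertexSubgroup Δ H (Δ.precClass v) ≤
      (vertexSubgroup Γ G (Γ.precClass u)).map φ.toMonoidHom := by
  have hj := SimpleGraph.joined_precClass hadj
  have hmapT := map_union_commonLink hmap
  rw [SimpleGraph.commonLink_precClass hadj] at hmapT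
  have hsymm := map_symm_eq hmapT
  let π : GraphProduct Δ H →* GraphProduct Γ G :=
    (retract Γ G (Γ.neighborSet u)).comp φ.symm.toMonoidHom
  have hπN : (vertexSubgroup Δ H N').map π = ⊥ := by
    rw [← Subgroup.map_map, map_symm_eq hmap, map_retract, hj.symm.disjoint.inter_eq,
      vertexSubgroup_empty]
  have hπT : (vertexSubgroup Δ H (commonLink Δ N')).map π =
      vertexSubgroup Γ G (Γ.neighborSet u) := by
    rw [← bot_sup_eq ((vertexSubgroup Δ H (commonLink Δ N')).map π), ← hπN,
      map_vertexSubgroup_union, ← Subgroup.map_map, hsymm, map_retract,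
      Set.inter_eq_left.2 Set.subset_union_right]
  have hπinj : Set.InjOn π (vertexSubgroup Δ H (commonLink Δ N')) := by
    intro x hx y hy hxy
    have hz : x * y⁻¹ ∈ vertexSubgroup Δ H (commonLink Δ N') := mul_mem hx (inv_mem hy)
    have h1 : retract Γ G (Γ.neighborSet u) (φ.symm (x * y⁻¹)) = 1 := by
      have h : π (x * y⁻¹) = 1 := by rw [map_mul, map_inv, hxy, mul_inv_cancel]
      exact h
    have h2 : φ.symm (x * y⁻¹) ∈ vertexSubgroup Γ G (Γ.precClass u ∪ Γ.neighborSet u) :=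
      hsymm ▸ ⟨_, vertexSubgroup_mono Set.subset_union_right hz, rfl⟩
    have h3 : φ.symm (x * y⁻¹) ∈ vertexSubgroup Γ G (Γ.precClass u) := by
      rw [← hj.retract_mul_retract h2, h1, mul_one]
      exact retract_mem _ _
    have h4 : x * y⁻¹ ∈ vertexSubgroup Δ H N' := hmap ▸ ⟨_, h3, by simp⟩
    have h5 : x * y⁻¹ ∈ vertexSubgroup Δ H N' ⊓ vertexSubgroup Δ H (commonLink Δ N') := ⟨h4, hz⟩
    rw [vertexSubgroup_inf, (joined_commonLink N').disjoint.inter_eq, vertexSubgroup_empty,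
      Subgroup.mem_bot] at h5
    exact mul_inv_eq_one.1 h5
  have hT : ConeFree Δ (commonLink Δ N') :=
    coneFree_of_map hH hπinj (SimpleGraph.coneFree_neighborSet hadj) hπT
  obtain ⟨v, hv⟩ : N'.Nonempty := by
    rw [Set.nonempty_iff_ne_empty]
    rintro rfl
    rw [vertexSubgroup_empty] at hmap
    exact map_ne_bot (injOn_equiv φ _) subset_rfl ⟨u, SimpleGraph.mem_precClass u⟩ hmap
  obtain ⟨w, hvw, hw⟩ := Δ.exists_isPrecMaximal v
  have hstar : ∀ x, commonLink Δ N' ⊆ Δ.vertexStar x → commonLink Δ N' ⊆ Δ.neighborSet x :=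
    fun x hx t ht => (hx ht).resolve_left fun h => hT t ht (h ▸ hx)
  have hTw : commonLink Δ N' ⊆ Δ.neighborSet w := hstar w fun t ht => hvw (ht v hv)
  have hTclass : Joined Δ (Δ.precClass w) (commonLink Δ N') :=
    fun x hx t ht => hstar x (fun t ht => hx.1 (hTw ht)) ht
  refine ⟨w, hw, fun z hz => ⟨φ.symm z, ?_, by simp⟩⟩
  refine mem_precClass_of_commute hu hadj
    (B := (vertexSubgroup Δ H (commonLink Δ N')).map φ.symm.toMonoidHom) ?_ ?_ ?_
  · exact hsymm ▸ Subgroup.map_mono (vertexSubgroup_mono Set.subset_union_right)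
  · rw [Subgroup.map_map]
    exact hπT
  · rintro _ ⟨b, hb, rfl⟩
    exact (hTclass.commute hz hb).map φ.symm.toMonoidHom

theorem exists_conj_precClass_le_map (hG : ∀ v, GraphicallyIrreducible (G v))
    (hH : ∀ w, GraphicallyIrreducible (H w)) (φ : GraphProduct Γ G ≃* GraphProduct Δ H)
    (hΓ : ∀ v v' : V, v ≠ v' → Γ.vertexStar v ≠ Γ.vertexStar v') {u : V}
    (hu : Γ.IsPrecMaximal u) :
    ∃ (g : GraphProduct Δ H) (v : W), Δ.IsPrecMaximal v ∧
      conjSubgroup g (vertexSubgroup Δ H (Δ.precClass v)) ≤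
        (vertexSubgroup Γ G (Γ.precClass u)).map φ.toMonoidHom := by
  have hadj : ∀ p, Γ.Adj u p → ¬ Γ.Prec u p := fun p => hu.not_prec_of_adj hΓ
  obtain ⟨N', g, hmap⟩ := exists_map_precClass_eq hG hH φ hu hadj
  obtain ⟨v, hv, hle⟩ := exists_precClass_le_map hH (φ := φ.trans (MulAut.conj g⁻¹)) (N' := N')
    hu hadj (by
      rw [map_trans_conj, hmap, conjSubgroup_conjSubgroup, inv_mul_cancel, conjSubgroup_one])
  refine ⟨g, v, hv, (Subgroup.map_mono hle).trans_eq ?_⟩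
  rw [map_trans_conj]
  exact (conjSubgroup_conjSubgroup _ _ _).trans (by rw [mul_inv_cancel, conjSubgroup_one])

end GraphProduct

theorem theorem1p11 {V W : Type*} [Finite V] [Finite W]
    (Φ : SimpleGraph V) (Ψ : SimpleGraph W)
    (G : V → Type*) (H : W → Type*) [∀ v, Group (G v)] [∀ w, Group (H w)]
    [∀ v, Nontrivial (G v)] [∀ w, Nontrivial (H w)]
    (hG : ∀ v, GraphicallyIrreducible (G v)) (hH : ∀ w, GraphicallyIrreducible (H w))
    (hΦ : ∀ v v' : V, v ≠ v' → Φ.vertexStar v ≠ Φ.vertexStar v')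
    (hΨ : ∀ w w' : W, w ≠ w' → Ψ.vertexStar w ≠ Ψ.vertexStar w')
    (φ : GraphProduct Φ G ≃* GraphProduct Ψ H)
    (u : V) (hu : Φ.IsPrecMaximal u) :
    ∃ (g : GraphProduct Ψ H) (v : W), Ψ.IsPrecMaximal v ∧
      (GraphProduct.vertexSubgroup Φ G (Φ.precClass u)).map φ.toMonoidHom =
        (GraphProduct.vertexSubgroup Ψ H (Ψ.precClass v)).map (MulAut.conj g).toMonoidHom := by
  obtain ⟨g, v, hv, hle⟩ := GraphProduct.exists_conj_precClass_le_map hG hH φ hΦ hu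
  obtain ⟨h, u', -, hle'⟩ := GraphProduct.exists_conj_precClass_le_map hH hG φ.symm hΨ hv
  refine ⟨g, v, hv, le_antisymm ?_ hle⟩
  -- The inclusions `n ⟨[u']⟩ n⁻¹ ≤ φ⁻¹(g ⟨[v]⟩ g⁻¹) ≤ ⟨[u]⟩` are equalities.
  let n := φ.symm g * h
  have h1 : ∀ x ∈ conjSubgroup n (GraphProduct.vertexSubgroup Φ G (Φ.precClass u')),
      φ x ∈ conjSubgroup g (GraphProduct.vertexSubgroup Ψ H (Ψ.precClass v)) := by
    intro x hx
    rw [← conjSubgroup_conjSubgroup] at hx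
    obtain ⟨y, hy, rfl⟩ := hx
    obtain ⟨z, hz, rfl⟩ := hle' hy
    exact ⟨z, hz, by simp⟩
  have h2 : conjSubgroup n (GraphProduct.vertexSubgroup Φ G (Φ.precClass u')) ≤
      GraphProduct.vertexSubgroup Φ G (Φ.precClass u) := by
    intro x hx
    obtain ⟨y, hy, hyx⟩ := hle (h1 x hx)
    exact φ.injective hyx ▸ hy
  have h3 : GraphProduct.vertexSubgroup Φ G (Φ.precClass u') ≤
      conjSubgroup n⁻¹ (GraphProduct.vertexSubgroup Φ G (Φ.precClass u)) := by
    intro x hx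
    rw [mem_conjSubgroup, inv_inv]
    exact h2 ⟨x, hx, rfl⟩
  have h4 : Φ.precClass u' = Φ.precClass u := SimpleGraph.precClass_eq <|
    GraphProduct.subset_of_conj_mem (fun x hx => mem_conjSubgroup.1 (h3 hx))
      (SimpleGraph.mem_precClass u')
  rw [h4] at h1 h3
  have h5 := GraphProduct.conjSubgroup_eq_of_le h3
  rintro _ ⟨x, hx, rfl⟩
  refine h1 x (mem_conjSubgroup.2 ?_)
  rw [← h5, mem_conjSubgroup]
  have h6 : n⁻¹⁻¹ * (n⁻¹ * x * n) * n⁻¹ = x := by group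
  rw [h6]
  exact hx
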